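/- Let $k$ be a field and let $\mathrm{Hmo}_0$ be the category of noncommutative motives over $k$: its objects are the small dg categories over $k$, its groups of morphisms are $$\mathrm{Hom}_{\mathrm{Hmo}_0}(\mathcal A,\mathcal B)=K_0\,\mathrm{rep}(\mathcal A,\mathcal B),$$ where $\mathrm{rep}(\mathcal A,\mathcal B)\subset\mathcal D(\mathcal A^{\mathrm{op}}\otimes\mathcal B)$ is the full triangulated subcategory of those $\mathcal A$-$\mathcal B$-bimodules $\mathsf B$ such that the right $\mathcal B$-module $\mathsf B(x,-)$ is a compact object of $\mathcal D(\mathcal B)$ for every object $x$ of $\mathcal A$; composition is the biadditive law induced by the derived tensor product, $([\mathsf B],[\mathsf B'])\mapsto[\mathsf B\otimes^{\mathbf L}_{\mathcal B}\mathsf B']$, and the identity of $\mathcal A$ is the class of the diagonal bimodule $(x,y)\mapsto\mathcal A(y,x)$. Let $U$ be the universal additive invariant, which is the identity on objects; for a $k$-algebra $A$, let $U(A)$ denote its value at the dg category with a single object whose dg algebra of endomorphisms is $A$, concentrated in degree $0$. **Theorem 8.1.** Let $A$ and $B$ be (finite-dimensional) central simple $k$-algebras. Then $U(A)\simeq U(B)$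 in $\mathrm{Hmo}_0$ if and only if $[A]=[B]$ in the Brauer group $\mathrm{Br}(k)$. -/

import Mathlib

open CategoryTheory CategoryTheory.Limits

universe u

/-- A small dg category over the field `k`: a category enriched over complexes of `k`-vector
spaces.  `comp h g f` is the composite `g ∘ f` of `f : x → y` of degree `q` and `g : y → z` of
degree `p`, as an element of degree `n = p + q`. -/
structure DGCat (k : Type u) [Field k] where
  Obj : Type u
  Hom : Obj → Obj → CochainComplex (ModuleCat.{u} k) ℤ
  comp {x y z : Obj} {p q n : ℤ} (h : p + q = n) :
    (Hom y z).X p →ₗ[k] (Hom x y).X q →ₗ[k] (Hom x z).X n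
  one (x : Obj) : (Hom x x).X 0
  one_comp {x y : Obj} {n : ℤ} (f : (Hom x y).X n) : comp (zero_add n) (one y) f = f
  comp_one {x y : Obj} {n : ℤ} (f : (Hom x y).X n) : comp (add_zero n) f (one x) = f
  assoc {w x y z : Obj} {p q r s t n : ℤ} (hs : p + q = s) (ht : q + r = t) (hsn : s + r = n)
    (htn : p + t = n) (f : (Hom y z).X p) (g : (Hom x y).X q) (e : (Hom w x).X r) :
    comp hsn (comp hs f g) e = comp htn f (comp ht g e)
  d_one (x : Obj) : (Hom x x).d 0 1 (one x) = 0
  d_comp {x y z : Obj} {p q n p' q' n' : ℤ} (h : p + q = n) (hp : p + 1 = p') (hq : q + 1 = q')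
    (hn : n + 1 = n') (g : (Hom y z).X p) (f : (Hom x y).X q) :
    (Hom x z).d n n' (comp h g f) =
      comp (by omega) ((Hom y z).d p p' g) f
        + p.negOnePow • comp (by omega) g ((Hom x y).d q q' f)

variable {k : Type u} [Field k]

/-! ### Right dg modules and the derived category -/

/-- A right dg module over `B`, i.e. a dg functor from `Bᵒᵖ` to complexes: complexes `M(w)` with
products `M(w)^p × B(w', w)^q → M(w')^(p+q)`, unital, associative and satisfying the Leibniz
rule. -/
structure DGMod (B : DGCat k) where
  obj : B.Obj → CochainComplex (ModuleCat.{u} k) ℤ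
  act {w w' : B.Obj} {p q n : ℤ} (h : p + q = n) :
    (obj w).X p →ₗ[k] (B.Hom w' w).X q →ₗ[k] (obj w').X n
  act_one {w : B.Obj} {n : ℤ} (m : (obj w).X n) : act (add_zero n) m (B.one w) = m
  act_act {w w' w'' : B.Obj} {p q r s t n : ℤ} (hs : p + q = s) (ht : q + r = t)
    (hsn : s + r = n) (htn : p + t = n)
    (m : (obj w).X p) (b : (B.Hom w' w).X q) (c : (B.Hom w'' w').X r) :
    act hsn (act hs m b) c = act htn m (B.comp ht b c)
  d_act {w w' : B.Obj} {p q n p' q' n' : ℤ} (h : p + q = n) (hp : p + 1 = p') (hq : q + 1 = q')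
    (hn : n + 1 = n') (m : (obj w).X p) (b : (B.Hom w' w).X q) :
    (obj w').d n n' (act h m b) =
      act (by omega) ((obj w).d p p' m) b
        + p.negOnePow • act (by omega) m ((B.Hom w' w).d q q' b)

namespace DGMod

variable {B : DGCat k}

/-- Morphisms of right dg modules: families of chain maps commuting with the action. -/
@[ext]
structure Hom (M N : DGMod B) where
  app (w : B.Obj) : M.obj w ⟶ N.obj w
  app_act {w w' : B.Obj} {p q n : ℤ} (h : p + q = n) (m : (M.obj w).X p)
    (b : (B.Hom w' w).X q) :
    (app w').f n (M.act h m b) = N.act h ((app w).f p m) b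

instance : Category (DGMod B) where
  Hom M N := Hom M N
  id M := { app := fun w => 𝟙 (M.obj w), app_act := by intros; simp }
  comp f g :=
    { app := fun w => f.app w ≫ g.app w
      app_act := by intros; simp [f.app_act, g.app_act] }
  id_comp f := by apply Hom.ext; funext w; exact Category.id_comp _
  comp_id f := by apply Hom.ext; funext w; exact Category.comp_id _
  assoc f g h := by apply Hom.ext; funext w; exact Category.assoc _ _ _

/-- Quasi-isomorphisms of right dg modules. -/
def quasiIso (B : DGCat k) : MorphismProperty (DGMod B) :=
  fun M N (f : DGMod.Hom M N) => ∀ w, QuasiIso (f.app w)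

/-- The derived category `D(B)`: the localization of the category of right dg modules with
respect to the quasi-isomorphisms. -/
abbrev Derived (B : DGCat k) := (quasiIso B).Localization

/-- `P` is h-projective (K-projective): every morphism from `P` to an acyclic dg module is
null-homotopic, by a homotopy of dg modules. -/
def IsHProjective (P : DGMod B) : Prop :=
  ∀ (N : DGMod B), (∀ w, (N.obj w).Acyclic) → ∀ f : DGMod.Hom P N,
    ∃ s : ∀ (w : B.Obj) (p q : ℤ), q + 1 = p → ((P.obj w).X p →ₗ[k] (N.obj w).X q),
      (∀ (w w' : B.Obj) (p q n p' n' : ℤ) (h : p + q = n) (h' : p' + q = n') (hp : p' + 1 = p)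
        (hn : n' + 1 = n) (m : (P.obj w).X p) (b : (B.Hom w' w).X q),
        s w' n n' hn (P.act h m b) = N.act h' (s w p p' hp m) b) ∧
      (∀ (w : B.Obj) (p q r : ℤ) (hq : q + 1 = p) (hr : p + 1 = r) (m : (P.obj w).X p),
        (f.app w).f p m =
          (N.obj w).d q p (s w p q hq m) + s w r p hr ((P.obj w).d p r m))

end DGMod

/-- An object `X` is compact if every morphism from `X` to a coproduct (indexed by a small set)
factors through a finite subcoproduct.  In a triangulated category with coproducts this says that
`⨁ Hom(X, Yᵢ) → Hom(X, ∐ Yᵢ)` is bijective: it is always injective, and this is its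
surjectivity. -/
def IsCompactObject {C : Type*} [Category C] (X : C) : Prop :=
  ∀ (ι : Type u) (Y : ι → C) (c : Cofan Y), Nonempty (IsColimit c) → ∀ f : X ⟶ c.pt,
    ∃ (s : Finset ι) (c' : Cofan (fun i : s => Y i)) (hc' : IsColimit c') (g : X ⟶ c'.pt),
      f = g ≫ Cofan.IsColimit.desc hc' (fun i => c.inj i)

/-- `M` belongs to `D_c(B)`. -/
def DGMod.IsCompact {B : DGCat k} (M : DGMod B) : Prop :=
  IsCompactObject.{u} ((DGMod.quasiIso B).Q.obj M)

/-! ### Bimodules -/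

/-- An `A`-`B`-bimodule, i.e. a dg functor from `A ⊗ Bᵒᵖ` to complexes: complexes `M(x, w)` with
a right action of `B` in the variable `w` and a left action of `A` in the variable `x`, which
commute and satisfy the Leibniz rule. -/
structure DGBimod (A B : DGCat k) where
  right : A.Obj → DGMod B
  lact {x x' : A.Obj} {w : B.Obj} {p q n : ℤ} (h : p + q = n) :
    (A.Hom x x').X p →ₗ[k] ((right x).obj w).X q →ₗ[k] ((right x').obj w).X n
  one_lact {x : A.Obj} {w : B.Obj} {n : ℤ} (m : ((right x).obj w).X n) :
    lact (zero_add n) (A.one x) m = m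
  lact_lact {x x' x'' : A.Obj} {w : B.Obj} {p q r s t n : ℤ} (hs : p + q = s) (ht : q + r = t)
    (hsn : s + r = n) (htn : p + t = n)
    (a : (A.Hom x' x'').X p) (a' : (A.Hom x x').X q) (m : ((right x).obj w).X r) :
    lact hsn (A.comp hs a a') m = lact htn a (lact ht a' m)
  lact_act {x x' : A.Obj} {w w' : B.Obj} {p q r s t n : ℤ} (hs : p + q = s) (ht : q + r = t)
    (hsn : s + r = n) (htn : p + t = n)
    (a : (A.Hom x x').X p) (m : ((right x).obj w).X q) (b : (B.Hom w' w).X r) :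
    (right x').act hsn (lact hs a m) b = lact htn a ((right x).act ht m b)
  d_lact {x x' : A.Obj} {w : B.Obj} {p q n p' q' n' : ℤ} (h : p + q = n) (hp : p + 1 = p')
    (hq : q + 1 = q') (hn : n + 1 = n') (a : (A.Hom x x').X p) (m : ((right x).obj w).X q) :
    ((right x').obj w).d n n' (lact h a m) =
      lact (by omega) ((A.Hom x x').d p p' a) m
        + p.negOnePow • lact (by omega) a (((right x).obj w).d q q' m)

namespace DGBimod

variable {A B C : DGCat k}

/-- The complex `M(x, w)`. -/
abbrev obj (M : DGBimod A B) (x : A.Obj) (w : B.Obj) : CochainComplex (ModuleCat.{u} k) ℤ :=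
  (M.right x).obj w

/-- The right action of `B`. -/
abbrev ract (M : DGBimod A B) {x : A.Obj} {w w' : B.Obj} {p q n : ℤ} (h : p + q = n) :
    (M.obj x w).X p →ₗ[k] (B.Hom w' w).X q →ₗ[k] (M.obj x w').X n :=
  (M.right x).act h

/-- Morphisms of bimodules: families of chain maps commuting with both actions. -/
@[ext]
structure Hom (M N : DGBimod A B) where
  app (x : A.Obj) : DGMod.Hom (M.right x) (N.right x)
  app_lact {x x' : A.Obj} {w : B.Obj} {p q n : ℤ} (h : p + q = n) (a : (A.Hom x x').X p)
    (m : (M.obj x w).X q) :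
    ((app x').app w).f n (M.lact h a m) = N.lact h a (((app x).app w).f q m)

instance : Category (DGBimod A B) where
  Hom M N := Hom M N
  id M :=
    { app := fun x => 𝟙 (M.right x)
      app_lact := by
        intro x x' w p q n h a m
        change (HomologicalComplex.Hom.f (𝟙 (M.obj x' w)) n) _ =
          M.lact h a ((HomologicalComplex.Hom.f (𝟙 (M.obj x w)) q) m)
        simp }
  comp {M N P} f g :=
    { app := fun x => (show M.right x ⟶ N.right x from f.app x) ≫ g.app x
      app_lact := by
        intro x x' w p q n h a m
        change (HomologicalComplex.Hom.f ((f.app x').app w ≫ (g.app x').app w) n) _ =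
          P.lact h a ((HomologicalComplex.Hom.f ((f.app x).app w ≫ (g.app x).app w) q) m)
        simp [f.app_lact, g.app_lact] }
  id_comp {M N} f := by
    apply Hom.ext; funext x
    exact Category.id_comp (show M.right x ⟶ N.right x from f.app x)
  comp_id {M N} f := by
    apply Hom.ext; funext x
    exact Category.comp_id (show M.right x ⟶ N.right x from f.app x)
  assoc {M N P Q} f g h := by
    apply Hom.ext; funext x
    exact Category.assoc (show M.right x ⟶ N.right x from f.app x)
      (show N.right x ⟶ P.right x from g.app x) (show P.right x ⟶ Q.right x from h.app x)

/-- The map in degree `n` at `(x, w)` of a morphism of bimodules. -/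
def Hom.map {M N : DGBimod A B} (f : Hom M N) (x : A.Obj) (w : B.Obj) (n : ℤ) :
    (M.obj x w).X n →ₗ[k] (N.obj x w).X n :=
  (((f.app x).app w).f n).hom

/-- Quasi-isomorphisms of bimodules. -/
def quasiIso (A B : DGCat k) : MorphismProperty (DGBimod A B) :=
  fun M N (f : DGBimod.Hom M N) => ∀ x w, QuasiIso ((f.app x).app w)

/-- The derived category `D(Aᵒᵖ ⊗ B)` of `A`-`B`-bimodules. -/
abbrev Derived (A B : DGCat k) := (quasiIso A B).Localization

/-- The image of a bimodule in the derived category. -/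
abbrev toDerived (M : DGBimod A B) : Derived A B := (quasiIso A B).Q.obj M

/-- The category `rep(A, B)`: the bimodules `M` with `M(x, -)` in `D_c(B)` for all `x`. -/
def IsRep (M : DGBimod A B) : Prop := ∀ x, (M.right x).IsCompact

/-- A short exact sequence `0 → X → Y → Z → 0` of bimodules. -/
def IsShortExact {X Y Z : DGBimod A B} (f : Hom X Y) (g : Hom Y Z) : Prop :=
  ∀ x w n, Function.Injective (f.map x w n) ∧ Function.Exact (f.map x w n) (g.map x w n) ∧
    Function.Surjective (g.map x w n)

/-- There is a distinguished triangle `X → Y → Z → X[1]` in `D(Aᵒᵖ ⊗ B)`: the distinguished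
triangles are those isomorphic to the triangle of a short exact sequence of bimodules. -/
def InTriangle (X Y Z : DGBimod A B) : Prop :=
  ∃ (X' Y' Z' : DGBimod A B) (f : Hom X' Y') (g : Hom Y' Z'), IsShortExact f g ∧
    Nonempty (X.toDerived ≅ X'.toDerived) ∧ Nonempty (Y.toDerived ≅ Y'.toDerived) ∧
    Nonempty (Z.toDerived ≅ Z'.toDerived)

/-- The diagonal `A`-`A`-bimodule `(x, w) ↦ A(w, x)`. -/
abbrev diag (A : DGCat k) : DGBimod A A where
  right x :=
    { obj := fun w => A.Hom w x
      act := A.comp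
      act_one := A.comp_one
      act_act := A.assoc
      d_act := A.d_comp }
  lact := A.comp
  one_lact := A.one_comp
  lact_lact := A.assoc
  lact_act := A.assoc
  d_lact := A.d_comp

/-- `T` together with the pairings `μ : M(x, b)^p × N(b, z)^q → T(x, z)^(p+q)` is the tensor
product `M ⊗_B N`: `μ` is balanced over `B`, compatible with the differentials and with the actions
of `A` and `C`, and in each degree it is the universal balanced family of bilinear maps. -/
structure TensorProduct (M : DGBimod A B) (N : DGBimod B C) (T : DGBimod A C) where
  μ {x : A.Obj} {b : B.Obj} {z : C.Obj} {p q n : ℤ} (h : p + q = n) :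
    (M.obj x b).X p →ₗ[k] (N.obj b z).X q →ₗ[k] (T.obj x z).X n
  balanced {x : A.Obj} {b b' : B.Obj} {z : C.Obj} {p q r s t n : ℤ} (hs : p + q = s)
    (ht : q + r = t) (hsn : s + r = n) (htn : p + t = n)
    (m : (M.obj x b).X p) (β : (B.Hom b' b).X q) (v : (N.obj b' z).X r) :
    μ hsn (M.ract hs m β) v = μ htn m (N.lact ht β v)
  lact_μ {x x' : A.Obj} {b : B.Obj} {z : C.Obj} {p q r s t n : ℤ} (hs : p + q = s)
    (ht : q + r = t) (hsn : s + r = n) (htn : p + t = n)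
    (a : (A.Hom x x').X p) (m : (M.obj x b).X q) (v : (N.obj b z).X r) :
    μ hsn (M.lact hs a m) v = T.lact htn a (μ ht m v)
  ract_μ {x : A.Obj} {b : B.Obj} {z z' : C.Obj} {p q r s t n : ℤ} (hs : p + q = s)
    (ht : q + r = t) (hsn : s + r = n) (htn : p + t = n)
    (m : (M.obj x b).X p) (v : (N.obj b z).X q) (c : (C.Hom z' z).X r) :
    T.ract hsn (μ hs m v) c = μ htn m (N.ract ht v c)
  d_μ {x : A.Obj} {b : B.Obj} {z : C.Obj} {p q n p' q' n' : ℤ} (h : p + q = n)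
    (hp : p + 1 = p') (hq : q + 1 = q') (hn : n + 1 = n')
    (m : (M.obj x b).X p) (v : (N.obj b z).X q) :
    (T.obj x z).d n n' (μ h m v) =
      μ (by omega) ((M.obj x b).d p p' m) v
        + p.negOnePow • μ (by omega) m ((N.obj b z).d q q' v)
  universal (x : A.Obj) (z : C.Obj) (n : ℤ) (W : Type u) [AddCommGroup W] [Module k W]
    (φ : ∀ (b : B.Obj) (p q : ℤ), p + q = n →
      ((M.obj x b).X p →ₗ[k] (N.obj b z).X q →ₗ[k] W))
    (hφ : ∀ (b b' : B.Obj) (p q r s t : ℤ) (hs : p + q = s) (ht : q + r = t) (hsn : s + r = n)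
      (htn : p + t = n) (m : (M.obj x b).X p) (β : (B.Hom b' b).X q) (v : (N.obj b' z).X r),
      φ b' s r hsn (M.ract hs m β) v = φ b p t htn m (N.lact ht β v)) :
    ∃! ψ : (T.obj x z).X n →ₗ[k] W,
      ∀ (b : B.Obj) (p q : ℤ) (h : p + q = n) (m : (M.obj x b).X p) (v : (N.obj b z).X q),
        ψ (μ h m v) = φ b p q h m v

/-- `P` is a derived tensor product `M ⊗ᴸ_B N`: it is isomorphic in `D(Aᵒᵖ ⊗ C)` to `M' ⊗_B N`,
where `M' → M` is a quasi-isomorphism of bimodules and `M'` is h-projective over `B`. -/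
def IsDerivedTensor (M : DGBimod A B) (N : DGBimod B C) (P : DGBimod A C) : Prop :=
  ∃ (M' : DGBimod A B) (f : M' ⟶ M) (T : DGBimod A C),
    quasiIso A B f ∧ (∀ x, (M'.right x).IsHProjective) ∧
    Nonempty (TensorProduct M' N T) ∧ Nonempty (T.toDerived ≅ P.toDerived)

end DGBimod

/-! ### Noncommutative motives -/

/-- The objects of the category `Hmo₀` of noncommutative motives are the small dg categories. -/
structure Hmo0 (k : Type u) [Field k] where
  dgCat : DGCat k

/-- The universal additive invariant on objects. -/
def U (A : DGCat k) : Hmo0 k := ⟨A⟩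

namespace Hmo0

/-- The subgroup of relations `[Y] = [X] + [Z]` for the distinguished triangles
`X → Y → Z → X[1]` in `rep(A, B)`. -/
def relations (A B : DGCat k) : AddSubgroup (FreeAbelianGroup {M : DGBimod A B // M.IsRep}) :=
  AddSubgroup.closure
    {r | ∃ X Y Z : {M : DGBimod A B // M.IsRep}, DGBimod.InTriangle X.1 Y.1 Z.1 ∧
      r = FreeAbelianGroup.of Y - FreeAbelianGroup.of X - FreeAbelianGroup.of Z}

/-- The group of morphisms in `Hmo₀` from `X` to `Y`: the Grothendieck group of the triangulated
category `rep(X, Y)`. -/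
abbrev Hom (X Y : Hmo0 k) :=
  FreeAbelianGroup {M : DGBimod X.dgCat Y.dgCat // M.IsRep} ⧸ relations X.dgCat Y.dgCat

variable {X Y Z : Hmo0 k}

/-- The class in the Grothendieck group of a bimodule in `rep(X, Y)`. -/
def cls (M : DGBimod X.dgCat Y.dgCat) (hM : M.IsRep) : Hom X Y :=
  QuotientAddGroup.mk (FreeAbelianGroup.of ⟨M, hM⟩)

/-- The composition law of `Hmo₀`, given by its graph: `IsComp α β γ` says that `γ = β ∘ α`.
Composition is the biadditive map `K₀ rep(X, Y) × K₀ rep(Y, Z) → K₀ rep(X, Z)` with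
`[M], [N] ↦ [M ⊗ᴸ_Y N]`; since the classes generate, its graph is the smallest biadditive relation
that contains all the triples `([M], [N], [M ⊗ᴸ_Y N])`. -/
inductive IsComp : Hom X Y → Hom Y Z → Hom X Z → Prop
  | tensor (M : DGBimod X.dgCat Y.dgCat) (N : DGBimod Y.dgCat Z.dgCat)
      (P : DGBimod X.dgCat Z.dgCat) (hM : M.IsRep) (hN : N.IsRep) (hP : P.IsRep) :
      DGBimod.IsDerivedTensor M N P → IsComp (cls M hM) (cls N hN) (cls P hP)
  | zero_left (β : Hom Y Z) : IsComp 0 β 0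
  | zero_right (α : Hom X Y) : IsComp α 0 0
  | sub_left (α α' : Hom X Y) (β : Hom Y Z) (γ γ' : Hom X Z) :
      IsComp α β γ → IsComp α' β γ' → IsComp (α - α') β (γ - γ')
  | sub_right (α : Hom X Y) (β β' : Hom Y Z) (γ γ' : Hom X Z) :
      IsComp α β γ → IsComp α β' γ' → IsComp α (β - β') (γ - γ')

/-- `ε` is the identity of `X` in `Hmo₀`: the class of the diagonal bimodule, which lies in
`rep(X, X)`. -/
def IsId (ε : Hom X X) : Prop :=
  ∃ h : (DGBimod.diag X.dgCat).IsRep, ε = cls (DGBimod.diag X.dgCat) h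

/-- `X` and `Y` are isomorphic in `Hmo₀`. -/
def Isomorphic (X Y : Hmo0 k) : Prop :=
  ∃ (α : Hom X Y) (β : Hom Y X) (ε : Hom X X) (η : Hom Y Y),
    IsId ε ∧ IsId η ∧ IsComp α β ε ∧ IsComp β α η

end Hmo0

/-! ### Algebras as dg categories -/

section Algebra

variable (k) (A : Type u) [Ring A] [Algebra k A]

/-- The part of degree `n` of `A`, viewed as a graded algebra concentrated in degree `0`. -/
def algDegree (n : ℤ) : Submodule k A where
  carrier := {a | n ≠ 0 → a = 0}
  add_mem' ha hb hn := by rw [ha hn, hb hn, add_zero]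
  zero_mem' _ := rfl
  smul_mem' c a ha hn := by rw [ha hn, smul_zero]

/-- A `k`-algebra `A` as a complex concentrated in degree `0`. -/
abbrev algComplex : CochainComplex (ModuleCat.{u} k) ℤ where
  X n := ModuleCat.of k (algDegree k A n)
  d _ _ := 0

theorem algDegree_mul {p q n : ℤ} (h : p + q = n) (a : algDegree k A p) (b : algDegree k A q) :
    (a : A) * (b : A) ∈ algDegree k A n := by
  intro hn
  by_cases hp : p = 0
  · rw [b.2 (by omega), mul_zero]
  · rw [a.2 hp, zero_mul]

/-- The multiplication of `A`, in degrees `p`, `q` and `p + q = n`. -/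
def algMul {p q n : ℤ} (h : p + q = n) :
    algDegree k A p →ₗ[k] algDegree k A q →ₗ[k] algDegree k A n :=
  LinearMap.mk₂ k (fun a b => ⟨a * b, algDegree_mul k A h a b⟩)
    (fun _ _ _ => Subtype.ext (add_mul _ _ _)) (fun _ _ _ => Subtype.ext (smul_mul_assoc _ _ _))
    (fun _ _ _ => Subtype.ext (mul_add _ _ _)) (fun _ _ _ => Subtype.ext (mul_smul_comm _ _ _))

/-- A `k`-algebra `A` as a dg category with a single object. -/
abbrev DGCat.ofAlgebra : DGCat k where
  Obj := PUnit
  Hom _ _ := algComplex k A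
  comp h := algMul k A h
  one _ := (⟨1, fun h => absurd rfl h⟩ : algDegree k A 0)
  one_comp _ := Subtype.ext (one_mul _)
  comp_one _ := Subtype.ext (mul_one _)
  assoc _ _ _ _ _ _ _ := Subtype.ext (mul_assoc _ _ _)
  d_one _ := rfl
  d_comp {x y z p q n p' q' n'} h hp hq hn g f := by
    change (0 : algDegree k A n') = algMul k A _ (0 : algDegree k A p') f
      + p.negOnePow • algMul k A _ g (0 : algDegree k A q')
    rw [map_zero, map_zero, smul_zero, add_zero]
    exact (LinearMap.zero_apply (σ₁₂ := RingHom.id k) (M := algDegree k A q)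
      (M₂ := algDegree k A n') f).symm

end Algebra

/-!
The proof attaches to an `A`-`B`-bimodule `M` the Euler characteristic of its cohomology,
`χ(M) = ∑ (-1)ⁿ dim Hⁿ(M)`, and reads off the Brauer classes from the divisibility of these numbers.

*From an isomorphism of motives to Brauer equivalence.* Since `B` is semisimple, every complex of
`B`-modules splits, equivariantly, into its cohomology and a contractible part
(`exists_equivariant_harmonic`). Hence every dg module has a model with zero differential, every
morphism of the derived category is represented by a morphism of dg modules
(`DGMod.HasMinimalModels.full_Q`), and the compact dg modules have finite-dimensional total
cohomology (`DGMod.IsCompact.hasFiniteHomology`). So `χ` is a homomorphism on `K₀ rep(A, B)`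
(`Hmo0.eulerHom`). The Künneth formula over the simple algebra `B`
(`DGBimod.TensorProduct.eulerChar_mul`) says that `χ(M) χ(N) = dim B · χ(M ⊗ᴸ N)`, and the diagonal
bimodule of `A` has Euler characteristic `dim A`; so mutually inverse `α` and `β` satisfy
`χ(α) χ(β) = dim A · dim B`. On the other hand the cohomology of an `A`-`B`-bimodule consists of
modules over the simple algebra `R = A ⊗ Bᵐᵒᵖ`, whose dimensions are multiples of the dimension `s`
of the simple `R`-module `S`; the same holds for `B`-`A`-bimodules by duality. Therefore
`s² ∣ dim R`. As `dim End_R(S) · dim R = s²`, the algebra `R` is isomorphic to `End_k(S)`, that is,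
`[A] = [B]` (`isBrauerEquivalent_of_sq_dvd`).

*From Brauer equivalence to an isomorphism of motives.* If `R = Mₙ(A) ≃ Mₘ(B)`, then `A` and `B` are
corners `e R e` and `f R f` of `R` for full idempotents `e` and `f`. The bimodules `e R f` and
`f R e` are inverse to each other: multiplication identifies `e R f ⊗_B f R e` with `A`
(`FullCorner.tensorProduct`). They are h-projective and compact because they are finitely generated
and projective, in the explicit form of `x i ∈ e R f` and `y i ∈ f R e` with `∑ i, x i * y i = e`.
-/

/-! ### Linear algebra over semisimple and simple algebras -/

/-- A linear map between modules over a semisimple ring is von Neumann regular. -/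
theorem LinearMap.exists_pseudoInverse {R V W : Type*} [Ring R] [IsSemisimpleRing R]
    [AddCommGroup V] [Module R V] [AddCommGroup W] [Module R W] (f : V →ₗ[R] W) :
    ∃ g : W →ₗ[R] V, ∀ v, f (g (f v)) = f v := by
  obtain ⟨h, hh⟩ := IsSemisimpleModule.lifting_property (R := R) f.rangeRestrict
    f.surjective_rangeRestrict LinearMap.id
  obtain ⟨g, hg⟩ := IsSemisimpleModule.extension_property (R := R) (LinearMap.range f).subtype
    (Submodule.subtype_injective _) h
  refine ⟨g, fun v => ?_⟩
  have h1 : g (f v) = h (f.rangeRestrict v) := LinearMap.congr_fun hg (f.rangeRestrict v)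
  have h2 := LinearMap.congr_fun hh (f.rangeRestrict v)
  rw [h1]
  exact congrArg Subtype.val h2

/-- `LinearMap.exists_pseudoInverse` for actions given as algebra homomorphisms. -/
theorem LinearMap.exists_equivariant_pseudoInverse {R V W : Type*} [Ring R] [Algebra k R]
    [IsSemisimpleRing R] [AddCommGroup V] [Module k V] [AddCommGroup W] [Module k W]
    (ρ : R →ₐ[k] Module.End k V) (σ : R →ₐ[k] Module.End k W) (f : V →ₗ[k] W)
    (hf : ∀ r v, f (ρ r v) = σ r (f v)) :
    ∃ g : W →ₗ[k] V, (∀ r w, g (σ r w) = ρ r (g w)) ∧ ∀ v, f (g (f v)) = f v := by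
  let _ : Module R V := Module.compHom V ρ.toRingHom
  let _ : Module R W := Module.compHom W σ.toRingHom
  obtain ⟨g, hg⟩ := LinearMap.exists_pseudoInverse (R := R)
    { toFun := f, map_add' := f.map_add, map_smul' := hf : V →ₗ[R] W }
  refine ⟨{ toFun := g, map_add' := g.map_add, map_smul' := fun c w => ?_ }, fun r w => ?_, hg⟩
  · have h := g.map_smul (algebraMap k R c) w
    change g (σ (algebraMap k R c) w) = ρ (algebraMap k R c) (g w) at h
    simpa [AlgHom.commutes, Module.algebraMap_end_apply] using h
  · exact g.map_smul r w

theorem finrank_eq_card_mul_of_linearEquiv {R : Type u} [Ring R] [Algebra k R] {a : ℕ}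
    {S V : Type u} [AddCommGroup S] [Module k S] [Module R S] [IsScalarTower k R S]
    [AddCommGroup V] [Module k V] [Module R V] [IsScalarTower k R V] [Module.Finite k S]
    (e : V ≃ₗ[R] Fin a → S) : Module.finrank k V = a * Module.finrank k S := by
  rw [(e.restrictScalars k).finrank_eq, Module.finrank_pi_fintype]
  simp

section SimpleAlgebra

variable {R : Type u} [Ring R] [IsSimpleRing R] [IsArtinianRing R]

/-- A simple Artinian ring has only one simple module, up to isomorphism. -/
theorem IsSimpleRing.nonempty_linearEquiv_of_isSimpleModule (S T : Type u) [AddCommGroup S]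
    [Module R S] [IsSimpleModule R S] [AddCommGroup T] [Module R T] [IsSimpleModule R T] :
    Nonempty (S ≃ₗ[R] T) := by
  obtain ⟨I, ⟨e⟩⟩ := IsSemisimpleRing.exists_linearEquiv_ideal_of_isSimpleModule R S
  obtain ⟨J, ⟨f⟩⟩ := IsSemisimpleRing.exists_linearEquiv_ideal_of_isSimpleModule R T
  have : IsSimpleModule R I := IsSimpleModule.congr e.symm
  have : IsSimpleModule R J := IsSimpleModule.congr f.symm
  obtain ⟨g⟩ := IsSimpleRing.isIsotypic R R J I
  exact ⟨e.trans (g.trans f.symm)⟩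

/-- Every finitely generated module over a simple Artinian ring is a power of the simple module. -/
theorem IsSimpleRing.exists_linearEquiv_fun (S V : Type u) [AddCommGroup S] [Module R S]
    [IsSimpleModule R S] [AddCommGroup V] [Module R V] [Module.Finite R V] :
    ∃ a : ℕ, Nonempty (V ≃ₗ[R] Fin a → S) :=
  IsIsotypicOfType.linearEquiv_fun (fun m _ =>
    IsSimpleRing.nonempty_linearEquiv_of_isSimpleModule m S)

variable [Algebra k R] [FiniteDimensional k R]

/-- Over a simple algebra `R`, the dimension of `Hom_R(V, W)` is `dim V * dim W / dim R`. -/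
theorem IsSimpleRing.finrank_hom_mul_finrank (V W : Type u) [AddCommGroup V] [Module k V]
    [Module R V] [IsScalarTower k R V] [Module.Finite k V] [AddCommGroup W] [Module k W]
    [Module R W] [IsScalarTower k R W] [Module.Finite k W] :
    Module.finrank k (V →ₗ[R] W) * Module.finrank k R =
      Module.finrank k V * Module.finrank k W := by
  obtain ⟨S, hS⟩ := IsSemisimpleModule.exists_simple_submodule R R
  have : Module.Finite R V := Module.Finite.of_restrictScalars_finite k R V
  have : Module.Finite k S := inferInstanceAs (Module.Finite k (S.restrictScalars k))
  obtain ⟨a, ⟨e⟩⟩ := IsSimpleRing.exists_linearEquiv_fun (R := R) S V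
  obtain ⟨r, ⟨f⟩⟩ := IsSimpleRing.exists_linearEquiv_fun (R := R) S R
  have hom (n : ℕ) : Module.finrank k ((Fin n → S) →ₗ[R] W) =
      n * Module.finrank k (S →ₗ[R] W) := by
    rw [← (LinearMap.lsum R (fun _ : Fin n => S) k).finrank_eq, Module.finrank_pi_fintype]
    simp
  have hV : Module.finrank k (V →ₗ[R] W) = a * Module.finrank k (S →ₗ[R] W) := by
    rw [← hom, (LinearEquiv.congrLeft W k e).finrank_eq]
  have hW : Module.finrank k W = r * Module.finrank k (S →ₗ[R] W) := by
    rw [← hom, ← (LinearEquiv.congrLeft W k f).finrank_eq,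
      (LinearMap.ringLmapEquivSelf R k W).finrank_eq]
  rw [hV, hW, finrank_eq_card_mul_of_linearEquiv (k := k) e,
    finrank_eq_card_mul_of_linearEquiv (k := k) f]
  ring

end SimpleAlgebra

open scoped TensorProduct in
/-- By Jacobson density, every `k`-linear endomorphism of a central simple algebra is a sum of maps
`x ↦ a * x * b`. -/
theorem AlgHom.mulLeftRight_surjective (A : Type u) [Ring A] [Algebra k A]
    [Algebra.IsCentral k A] [IsSimpleRing A] [FiniteDimensional k A] :
    Function.Surjective (AlgHom.mulLeftRight k A) := by
  let _ : Module (A ⊗[k] Aᵐᵒᵖ) A := Module.compHom A (AlgHom.mulLeftRight k A).toRingHom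
  have smul_def (t : A ⊗[k] Aᵐᵒᵖ) (a : A) : t • a = AlgHom.mulLeftRight k A t a := rfl
  have tmul_smul (a : A) (b : Aᵐᵒᵖ) (x : A) : (a ⊗ₜ[k] b) • x = a * x * b.unop := by
    rw [smul_def, AlgHom.mulLeftRight_apply]
  have : IsSimpleModule (A ⊗[k] Aᵐᵒᵖ) A := by
    refine isSimpleModule_iff_toSpanSingleton_surjective.2 ⟨inferInstance, fun x hx => ?_⟩
    let I : TwoSidedIdeal A := TwoSidedIdeal.mk' {a | ∃ t : A ⊗[k] Aᵐᵒᵖ, t • x = a}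
      ⟨0, by simp [smul_def]⟩
      (by rintro _ _ ⟨s, rfl⟩ ⟨t, rfl⟩; exact ⟨s + t, add_smul _ _ _⟩)
      (by rintro _ ⟨s, rfl⟩; exact ⟨-s, neg_smul _ _⟩)
      (by
        rintro a _ ⟨s, rfl⟩
        refine ⟨(a ⊗ₜ 1) * s, ?_⟩
        rw [mul_smul, tmul_smul]; simp)
      (by
        rintro _ a ⟨s, rfl⟩
        refine ⟨(1 ⊗ₜ MulOpposite.op a) * s, ?_⟩
        rw [mul_smul, tmul_smul]; simp)
    have hI : I = ⊤ := by
      refine (eq_bot_or_eq_top I).resolve_left fun h => hx ?_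
      have : x ∈ I := by
        rw [TwoSidedIdeal.mem_mk']
        exact ⟨1, one_smul _ _⟩
      rwa [h] at this
    intro a
    have : a ∈ I := hI ▸ trivial
    rw [TwoSidedIdeal.mem_mk'] at this
    exact this
  intro f
  have hcomm (φ : Module.End (A ⊗[k] Aᵐᵒᵖ) A) (x : A) : f (φ x) = φ (f x) := by
    have hl (x : A) : φ x = x * φ 1 := by
      have := φ.map_smul (x ⊗ₜ 1) 1
      rw [tmul_smul, tmul_smul] at this
      simpa using this
    have hr (x : A) : φ x = φ 1 * x := by
      have := φ.map_smul (1 ⊗ₜ MulOpposite.op x) 1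
      rw [tmul_smul, tmul_smul] at this
      simpa using this
    obtain ⟨c, hc⟩ := (Algebra.IsCentral.mem_center_iff k).1
      (Subalgebra.mem_center_iff.2 fun x => (hl x).symm.trans (hr x))
    have hs (x : A) : φ x = c • x := by rw [hr, hc, Algebra.smul_def]
    rw [hs, hs, map_smul]
  let F : Module.End (Module.End (A ⊗[k] Aᵐᵒᵖ) A) A :=
    { toFun := f, map_add' := f.map_add, map_smul' := hcomm }
  let b := Module.finBasis k A
  classical
  obtain ⟨r, hr⟩ := jacobson_density F (Finset.univ.image b)
  refine ⟨r, b.ext fun i => ?_⟩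
  exact (hr (b i) (Finset.mem_image_of_mem _ (Finset.mem_univ i))).symm

theorem AlgHom.mulLeftRight_bijective (A : Type u) [Ring A] [Algebra k A]
    [Algebra.IsCentral k A] [IsSimpleRing A] [FiniteDimensional k A] :
    Function.Bijective (AlgHom.mulLeftRight k A) := by
  have hs := AlgHom.mulLeftRight_surjective (k := k) A
  refine ⟨?_, hs⟩
  have : Module.finrank k (TensorProduct k A Aᵐᵒᵖ) = Module.finrank k (Module.End k A) := by
    rw [Module.finrank_tensorProduct, Module.finrank_linearMap,
      ← (MulOpposite.opLinearEquiv k : A ≃ₗ[k] Aᵐᵒᵖ).finrank_eq]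
  exact (LinearMap.injective_iff_surjective_of_finrank_eq_finrank
    (f := (AlgHom.mulLeftRight k A).toLinearMap) this).2 hs

open scoped TensorProduct in
/-- The tensor product of a central simple algebra and a simple algebra is simple. -/
theorem IsSimpleRing.tensorProduct (A B : Type u) [Ring A] [Algebra k A]
    [Algebra.IsCentral k A] [IsSimpleRing A] [FiniteDimensional k A] [Ring B] [Algebra k B]
    [IsSimpleRing B] : IsSimpleRing (A ⊗[k] B) := by
  -- By `AlgHom.mulLeftRight_surjective`, two-sided ideals are stable under all maps `f ⊗ 1`.
  have mem (I : TwoSidedIdeal (A ⊗[k] B)) (x : A ⊗[k] B) (hx : x ∈ I) (f : A →ₗ[k] A) :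
      f.rTensor B x ∈ I := by
    obtain ⟨t, rfl⟩ := AlgHom.mulLeftRight_surjective (k := k) A f
    induction t with
    | zero => simp [I.zero_mem]
    | add s t hs ht =>
      rw [map_add, LinearMap.rTensor_add]
      exact I.add_mem hs ht
    | tmul a b =>
      have key (y : A ⊗[k] B) : (AlgHom.mulLeftRight k A (a ⊗ₜ b)).rTensor B y =
          (a ⊗ₜ 1) * y * (b.unop ⊗ₜ 1) := by
        induction y with
        | zero => simp
        | add y z hy hz => rw [map_add, hy, hz, mul_add, add_mul]
        | tmul y z => simp
      rw [key]
      exact I.mul_mem_right _ _ (I.mul_mem_left _ _ hx)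
  let b := Module.finBasis k A
  let c (i) : A ⊗[k] B →ₗ[k] B := TensorProduct.lid k B ∘ₗ (b.coord i).rTensor B
  have expand (x : A ⊗[k] B) : x = ∑ i, b i ⊗ₜ c i x := by
    induction x with
    | zero => simp
    | add x y hx hy =>
      simp only [map_add, TensorProduct.tmul_add, Finset.sum_add_distrib]
      rw [← hx, ← hy]
    | tmul x y =>
      simp only [c, LinearMap.comp_apply, LinearMap.rTensor_tmul, LinearEquiv.coe_coe,
        TensorProduct.lid_tmul, ← TensorProduct.smul_tmul, Module.Basis.coord_apply]
      rw [← TensorProduct.sum_tmul, b.sum_repr]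
  refine ⟨⟨fun I => or_iff_not_imp_left.2 fun hI => ?_⟩⟩
  obtain ⟨x, hx, hx0⟩ : ∃ x ∈ I, x ≠ 0 := by
    by_contra! h
    exact hI (eq_bot_iff.2 fun x hx => by simpa using h x hx)
  obtain ⟨i, hi⟩ : ∃ i, c i x ≠ 0 := by
    by_contra! h
    exact hx0 (by rw [expand x]; simp [h])
  -- The map `f = (coordinate i) • 1` moves a nonzero coordinate of `x` into `1 ⊗ B`.
  have h1 : (1 : A) ⊗ₜ[k] c i x ∈ I := by
    have h := mem I x hx (LinearMap.toSpanSingleton k A 1 ∘ₗ b.coord i)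
    have h2 : (LinearMap.toSpanSingleton k A 1 ∘ₗ b.coord i).rTensor B x = 1 ⊗ₜ c i x := by
      generalize x = y
      induction y with
      | zero => simp
      | add x y hx hy => simp only [map_add, TensorProduct.tmul_add, hx, hy]
      | tmul x y => simp [c, TensorProduct.smul_tmul]
    rwa [h2] at h
  have h3 : I.comap (Algebra.TensorProduct.includeRight : B →ₐ[k] A ⊗[k] B) = ⊤ := by
    refine (eq_bot_or_eq_top _).resolve_left fun h => hi ?_
    have : c i x ∈ I.comap (Algebra.TensorProduct.includeRight : B →ₐ[k] A ⊗[k] B) := by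
      rw [TwoSidedIdeal.mem_comap]; exact h1
    rwa [h] at this
  have h4 : (1 : B) ∈ I.comap (Algebra.TensorProduct.includeRight : B →ₐ[k] A ⊗[k] B) :=
    h3 ▸ trivial
  rw [TwoSidedIdeal.mem_comap, map_one] at h4
  exact I.one_mem_iff.1 h4

open scoped TensorProduct in
/-- If the square of the dimension of a simple module over `A ⊗ Bᵐᵒᵖ` divides the dimension of
this algebra, then the algebra is split, and `A` and `B` are Brauer equivalent. -/
theorem isBrauerEquivalent_of_sq_dvd (A B : CSA.{u, u} k) (S : Type u) [AddCommGroup S] [Module k S]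
    [Module (A ⊗[k] (B : Type u)ᵐᵒᵖ) S] [IsScalarTower k (A ⊗[k] (B : Type u)ᵐᵒᵖ) S]
    [IsSimpleModule (A ⊗[k] (B : Type u)ᵐᵒᵖ) S] [Module.Finite k S]
    (h : Module.finrank k S * Module.finrank k S ∣ Module.finrank k (A ⊗[k] (B : Type u)ᵐᵒᵖ)) :
    IsBrauerEquivalent A B := by
  let R := A ⊗[k] (B : Type u)ᵐᵒᵖ
  have : IsSimpleRing R := IsSimpleRing.tensorProduct _ _
  have : IsArtinianRing R := IsArtinianRing.of_finite k R
  have hSR := IsSimpleRing.finrank_hom_mul_finrank (k := k) (R := R) S S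
  have hR : Module.finrank k R = Module.finrank k S * Module.finrank k S :=
    Nat.dvd_antisymm ⟨_, by rw [← hSR, mul_comm]⟩ h
  have : Nontrivial S := IsSimpleModule.nontrivial R S
  let φ : R →ₐ[k] Module.End k S := Algebra.lsmul k k S
  have hφ : Function.Bijective φ := by
    have inj : Function.Injective φ := RingHom.injective φ.toRingHom
    refine ⟨inj, ?_⟩
    exact (LinearMap.injective_iff_surjective_of_finrank_eq_finrank (f := φ.toLinearMap)
      (by rw [Module.finrank_linearMap, hR])).1 inj
  -- `M_b(A) ≃ A ⊗ (B ⊗ Bᵐᵒᵖ) ≃ B ⊗ (A ⊗ Bᵐᵒᵖ) ≃ M_s(B)` for `b = dim B` and `s = dim S`.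
  let e₁ : R ≃ₐ[k] Matrix (Fin (Module.finrank k S)) (Fin (Module.finrank k S)) k :=
    (AlgEquiv.ofBijective φ hφ).trans (algEquivMatrix (Module.finBasis k S))
  let e₂ : (B : Type u) ⊗[k] (B : Type u)ᵐᵒᵖ ≃ₐ[k]
      Matrix (Fin (Module.finrank k B)) (Fin (Module.finrank k B)) k :=
    (AlgEquiv.ofBijective _ (AlgHom.mulLeftRight_bijective (k := k) B)).trans
      (algEquivMatrix (Module.finBasis k B))
  refine ⟨Module.finrank k B, Module.finrank k S, Module.finrank_pos.ne', Module.finrank_pos.ne',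
    ⟨?_⟩⟩
  refine (matrixEquivTensor _ k A).trans
    (.trans ?_ (matrixEquivTensor _ k B).symm)
  exact (Algebra.TensorProduct.congr .refl e₂.symm).trans
    (((Algebra.TensorProduct.assoc k k k A B (B : Type u)ᵐᵒᵖ).symm.trans
      (Algebra.TensorProduct.congr (Algebra.TensorProduct.comm k A B) .refl)).trans
      ((Algebra.TensorProduct.assoc k k k B A (B : Type u)ᵐᵒᵖ).trans
        (Algebra.TensorProduct.congr .refl e₁)))

/-- The right action of `R` on the dual of a left `R`-module. -/
def dualAction {R V : Type u} [Ring R] [Algebra k R] [AddCommGroup V] [Module k V]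
    (ρ : R →ₐ[k] Module.End k V) : Rᵐᵒᵖ →ₐ[k] Module.End k (Module.Dual k V) where
  toFun r := (ρ r.unop).dualMap
  map_one' := by ext; simp
  map_mul' a b := by ext; simp
  map_zero' := by ext; simp
  map_add' a b := by ext; simp
  commutes' c := by ext; simp [Module.algebraMap_end_apply, AlgHom.commutes]

/-- The pairings `β : V × W → k` with `β (v b, w) = β (v, b w)`, for a right `B`-module `V` and a
left `B`-module `W`. -/
def balancedPairing {B V W : Type u} [Ring B] [Algebra k B] [AddCommGroup V] [Module k V]
    [AddCommGroup W] [Module k W] (ρ : Bᵐᵒᵖ →ₐ[k] Module.End k V) (σ : B →ₐ[k] Module.End k W) :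
    Submodule k (V →ₗ[k] W →ₗ[k] k) where
  carrier := {β | ∀ b v w, β (ρ (MulOpposite.op b) v) w = β v (σ b w)}
  add_mem' h h' b v w := by simp [h b v w, h' b v w]
  zero_mem' b v w := rfl
  smul_mem' c β h b v w := by simp [h b v w]

/-- Balanced pairings are the homomorphisms from `V` to the dual of `W`. -/
theorem finrank_balancedPairing_mul {B V W : Type u} [Ring B] [Algebra k B] [IsSimpleRing B]
    [FiniteDimensional k B] [AddCommGroup V] [Module k V] [Module.Finite k V]
    [AddCommGroup W] [Module k W] [Module.Finite k W]
    (ρ : Bᵐᵒᵖ →ₐ[k] Module.End k V) (σ : B →ₐ[k] Module.End k W) :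
    Module.finrank k (balancedPairing ρ σ) * Module.finrank k B =
      Module.finrank k V * Module.finrank k W := by
  have : IsArtinianRing Bᵐᵒᵖ := IsArtinianRing.of_finite k Bᵐᵒᵖ
  let _ : Module Bᵐᵒᵖ V := Module.compHom V ρ.toRingHom
  have : IsScalarTower k Bᵐᵒᵖ V := ⟨fun c b v => by
    change ρ (c • b) v = c • ρ b v
    rw [map_smul]; rfl⟩
  let _ : Module Bᵐᵒᵖ (Module.Dual k W) := Module.compHom _ (dualAction σ).toRingHom
  have smul_def (b : Bᵐᵒᵖ) (f : Module.Dual k W) (w : W) : (b • f) w = f (σ b.unop w) := rfl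
  have : IsScalarTower k Bᵐᵒᵖ (Module.Dual k W) := ⟨fun c b f => by
    ext w
    rw [LinearMap.smul_apply, smul_def, smul_def]
    simp⟩
  have h := IsSimpleRing.finrank_hom_mul_finrank (k := k) (R := Bᵐᵒᵖ) V (Module.Dual k W)
  rw [Subspace.dual_finrank_eq, ← (MulOpposite.opLinearEquiv k : B ≃ₗ[k] Bᵐᵒᵖ).finrank_eq] at h
  rw [← h]
  congr 1
  refine LinearEquiv.finrank_eq
    { toFun := fun β =>
        { toFun := β.1
          map_add' := β.1.map_add
          map_smul' := fun b v => by
            ext w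
            exact β.2 b.unop v w }
      map_add' := fun _ _ => rfl
      map_smul' := fun _ _ => rfl
      invFun := fun f => ⟨f.restrictScalars k, fun b v w => by
        exact LinearMap.congr_fun (f.map_smul (MulOpposite.op b) v) w⟩
      left_inv := fun _ => rfl
      right_inv := fun _ => rfl }

/-- Over a simple algebra, all dimensions are multiples of the dimension of the simple module. -/
theorem finrank_dvd_of_isSimpleModule {R S V : Type u} [Ring R] [Algebra k R] [IsSimpleRing R]
    [FiniteDimensional k R] [AddCommGroup S] [Module k S] [Module R S] [IsScalarTower k R S]
    [IsSimpleModule R S] [Module.Finite k S] [AddCommGroup V] [Module k V] [Module.Finite k V]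
    (ρ : R →ₐ[k] Module.End k V) : Module.finrank k S ∣ Module.finrank k V := by
  have : IsArtinianRing R := IsArtinianRing.of_finite k R
  let _ : Module R V := Module.compHom V ρ.toRingHom
  have : IsScalarTower k R V := ⟨fun c b v => by
    change ρ (c • b) v = c • ρ b v
    rw [map_smul]; rfl⟩
  have : Module.Finite R V := Module.Finite.of_restrictScalars_finite k R V
  obtain ⟨a, ⟨e⟩⟩ := IsSimpleRing.exists_linearEquiv_fun (R := R) S V
  exact ⟨a, by rw [finrank_eq_card_mul_of_linearEquiv (k := k) e, mul_comm]⟩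

open scoped TensorProduct in
/-- The dimensions of `B`-`A`-bimodules are multiples of the dimension of the simple
`A`-`B`-bimodule, because their duals are `A`-`B`-bimodules. -/
theorem finrank_dvd_of_isSimpleModule_of_swap {A B S V : Type u} [Ring A] [Algebra k A] [Ring B]
    [Algebra k B] [IsSimpleRing (A ⊗[k] Bᵐᵒᵖ)] [FiniteDimensional k (A ⊗[k] Bᵐᵒᵖ)]
    [AddCommGroup S] [Module k S] [Module (A ⊗[k] Bᵐᵒᵖ) S] [IsScalarTower k (A ⊗[k] Bᵐᵒᵖ) S]
    [IsSimpleModule (A ⊗[k] Bᵐᵒᵖ) S] [Module.Finite k S] [AddCommGroup V] [Module k V]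
    [Module.Finite k V] (ρ : B ⊗[k] Aᵐᵒᵖ →ₐ[k] Module.End k V) :
    Module.finrank k S ∣ Module.finrank k V := by
  let left : A →ₐ[k] Module.End k (Module.Dual k V) :=
    (dualAction (ρ.comp Algebra.TensorProduct.includeRight)).comp (AlgEquiv.opOp k A).toAlgHom
  let right : Bᵐᵒᵖ →ₐ[k] Module.End k (Module.Dual k V) :=
    dualAction (ρ.comp Algebra.TensorProduct.includeLeft)
  rw [← Subspace.dual_finrank_eq (V := V)]
  refine finrank_dvd_of_isSimpleModule (R := A ⊗[k] Bᵐᵒᵖ)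
    (Algebra.TensorProduct.lift left right fun a b => ?_)
  have h : ρ (b.unop ⊗ₜ 1) * ρ (1 ⊗ₜ MulOpposite.op a) =
      ρ (1 ⊗ₜ MulOpposite.op a) * ρ (b.unop ⊗ₜ 1) := by
    rw [← map_mul, ← map_mul]; simp
  ext f v
  exact congrArg f (LinearMap.congr_fun h v)

/-- A finite-dimensional simple algebra has a finite-dimensional simple module. -/
theorem exists_isSimpleModule (R : Type u) [Ring R] [Algebra k R] [IsSimpleRing R]
    [FiniteDimensional k R] : ∃ S : Submodule R R, IsSimpleModule R S ∧ Module.Finite k S := by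
  have : IsArtinianRing R := IsArtinianRing.of_finite k R
  obtain ⟨S, hS⟩ := IsSemisimpleModule.exists_simple_submodule R R
  exact ⟨S, hS, inferInstanceAs (Module.Finite k (S.restrictScalars k))⟩

/-! ### Harmonic decompositions of complexes -/

/-- An idempotent endomorphism `e` of a complex of vector spaces, homotopic to the identity by `h`,
on whose range the differential vanishes.  Its range is a space of harmonic representatives of the
cohomology. The maps `h p q` matter only for `q + 1 = p`. -/
structure Harmonic (K : CochainComplex (ModuleCat.{u} k) ℤ) where
  e (n : ℤ) : K.X n →ₗ[k] K.X n
  h (p q : ℤ) : K.X p →ₗ[k] K.X q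
  d_e (n m : ℤ) (x : K.X n) : K.d n m (e n x) = 0
  e_d (n m : ℤ) (x : K.X n) : e m (K.d n m x) = 0
  e_e (n : ℤ) (x : K.X n) : e n (e n x) = e n x
  homotopy {p q r : ℤ} (hq : q + 1 = p) (hr : p + 1 = r) (x : K.X p) :
    x = e p x + (K.d q p (h p q x) + h r p (K.d p r x))

namespace Harmonic

variable {K L : CochainComplex (ModuleCat.{u} k) ℤ} (H : Harmonic K) (H' : Harmonic L)

theorem e_coe {n : ℤ} (x : LinearMap.range (H.e n)) : H.e n x = x := by
  obtain ⟨_, y, rfl⟩ := x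
  exact H.e_e n y

theorem d_coe {n : ℤ} (m : ℤ) (x : LinearMap.range (H.e n)) : K.d n m x = 0 := by
  rw [← H.e_coe x, H.d_e]

/-- The complex of harmonic elements. -/
abbrev complex : CochainComplex (ModuleCat.{u} k) ℤ where
  X n := ModuleCat.of k (LinearMap.range (H.e n))
  d _ _ := 0

/-- The inclusion of the harmonic elements. -/
def ι : H.complex ⟶ K where
  f n := ModuleCat.ofHom (LinearMap.range (H.e n)).subtype
  comm' i j _ := by
    ext x
    exact H.d_coe j x

/-- The projection to the harmonic elements. -/
def π : K ⟶ H.complex where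
  f n := ModuleCat.ofHom (H.e n).rangeRestrict
  comm' i j _ := by
    ext x
    exact (H.e_d i j x).symm

theorem ι_π : H.ι ≫ H.π = 𝟙 _ := by
  ext n x
  exact H.e_coe x

/-- The complex of harmonic elements is homotopy equivalent to the given one. -/
noncomputable def homotopyEquiv : HomotopyEquiv K H.complex where
  hom := H.π
  inv := H.ι
  homotopyInvHomId := Homotopy.ofEq H.ι_π
  homotopyHomInvId :=
    { hom := fun i j => if j + 1 = i then -ModuleCat.ofHom (H.h i j) else 0
      zero := fun i j hij => if_neg hij
      comm := fun i => by
        rw [dNext_eq _ (show (ComplexShape.up ℤ).Rel i (i + 1) from rfl),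
          prevD_eq _ (show (ComplexShape.up ℤ).Rel (i - 1) i from sub_add_cancel i 1),
          if_pos rfl, if_pos (sub_add_cancel i 1)]
        ext x
        have := H.homotopy (sub_add_cancel i 1) rfl x
        change H.e i x = -(H.h (i + 1) i (K.d i (i + 1) x)) +
          K.d (i - 1) i (-(H.h i (i - 1) x)) + x
        rw [map_neg]
        nth_rewrite 4 [this]
        abel }

instance : QuasiIso H.π := inferInstanceAs (QuasiIso H.homotopyEquiv.hom)

instance : QuasiIso H.ι := inferInstanceAs (QuasiIso H.homotopyEquiv.inv)

end Harmonic

section ZeroDifferential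

variable {K L : CochainComplex (ModuleCat.{u} k) ℤ}

theorem isIso_homologyπ_iCycles (hK : ∀ i j, K.d i j = 0) (n : ℤ) :
    IsIso (K.iCycles n) ∧ IsIso (K.homologyπ n) :=
  ⟨K.isIso_iCycles n (n + 1) (by simp) (hK _ _), K.isIso_homologyπ (n - 1) n (by simp) (hK _ _)⟩

/-- The cohomology of a complex with zero differential. -/
noncomputable def homologyIsoOfZero (hK : ∀ i j, K.d i j = 0) (n : ℤ) : K.homology n ≅ K.X n :=
  have := (isIso_homologyπ_iCycles hK n).1
  have := (isIso_homologyπ_iCycles hK n).2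
  (asIso (K.homologyπ n)).symm ≪≫ asIso (K.iCycles n)

theorem homologyIsoOfZero_naturality (hK : ∀ i j, K.d i j = 0) (hL : ∀ i j, L.d i j = 0)
    (f : K ⟶ L) (n : ℤ) :
    f.f n = (homologyIsoOfZero hK n).inv ≫ HomologicalComplex.homologyMap f n ≫
      (homologyIsoOfZero hL n).hom := by
  have := (isIso_homologyπ_iCycles hK n).1
  have := (isIso_homologyπ_iCycles hK n).2
  have := (isIso_homologyπ_iCycles hL n).1
  have := (isIso_homologyπ_iCycles hL n).2
  simp [homologyIsoOfZero]

theorem bijective_of_quasiIso (hK : ∀ i j, K.d i j = 0) (hL : ∀ i j, L.d i j = 0) (f : K ⟶ L)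
    [QuasiIso f] (n : ℤ) : Function.Bijective (f.f n) := by
  have h : IsIso (f.f n) := by
    rw [homologyIsoOfZero_naturality hK hL f n]
    infer_instance
  exact ConcreteCategory.bijective_of_isIso (f.f n)

theorem ext_of_homologyMap (hK : ∀ i j, K.d i j = 0) (hL : ∀ i j, L.d i j = 0) {f g : K ⟶ L}
    (h : ∀ n, HomologicalComplex.homologyMap f n = HomologicalComplex.homologyMap g n) :
    f = g := by
  ext1 n
  rw [homologyIsoOfZero_naturality hK hL f n, homologyIsoOfZero_naturality hK hL g n, h]

end ZeroDifferential

/-- Each cohomology class has a unique harmonic representative. -/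
noncomputable def Harmonic.homologyEquiv {K : CochainComplex (ModuleCat.{u} k) ℤ} (H : Harmonic K)
    (n : ℤ) : K.homology n ≃ₗ[k] LinearMap.range (H.e n) :=
  (H.homotopyEquiv.toHomologyIso n ≪≫
    homologyIsoOfZero (K := H.complex) (fun _ _ => rfl) n).toLinearEquiv

/-- Over a semisimple algebra, every complex has an equivariant harmonic decomposition. -/
theorem exists_equivariant_harmonic {R : Type*} [Ring R] [Algebra k R] [IsSemisimpleRing R]
    (K : CochainComplex (ModuleCat.{u} k) ℤ) (ρ : ∀ n, R →ₐ[k] Module.End k (K.X n))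
    (hρ : ∀ n m r x, K.d n m (ρ n r x) = ρ m r (K.d n m x)) :
    ∃ H : Harmonic K, (∀ n r x, H.e n (ρ n r x) = ρ n r (H.e n x)) ∧
      ∀ p q r x, H.h p q (ρ p r x) = ρ q r (H.h p q x) := by
  have ex (q p : ℤ) := LinearMap.exists_equivariant_pseudoInverse (ρ q) (ρ p) (K.d q p).hom
    (fun r x => hρ q p r x)
  choose s hs hd using ex
  replace hd (q p : ℤ) (x : K.X q) : K.d q p (s q p (K.d q p x)) = K.d q p x := hd q p x
  have hdd (i j l : ℤ) (x : K.X i) : K.d j l (K.d i j x) = 0 := by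
    rw [← ModuleCat.comp_apply, K.d_comp_d]; rfl
  -- `y n x` is `(1 - s d) x`, and `(1 - d s) (1 - s d)` is the harmonic projection.
  let y (n : ℤ) : K.X n →ₗ[k] K.X n := LinearMap.id - s n (n + 1) ∘ₗ (K.d n (n + 1)).hom
  have y_apply (n : ℤ) (x) : y n x = x - s n (n + 1) (K.d n (n + 1) x) := rfl
  let e (n : ℤ) : K.X n →ₗ[k] K.X n :=
    (LinearMap.id - (K.d (n - 1) n).hom ∘ₗ s (n - 1) n) ∘ₗ y n
  have e_apply (n : ℤ) (x) : e n x = y n x - K.d (n - 1) n (s (n - 1) n (y n x)) := rfl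
  have y_d (i n : ℤ) (x) : y n (K.d i n x) = K.d i n x := by
    rw [y_apply, hdd, map_zero, sub_zero]
  have d_y (n m : ℤ) (x) : K.d n m (y n x) = 0 := by
    by_cases h : n + 1 = m
    · subst h
      rw [y_apply, map_sub, hd, sub_self]
    · rw [K.shape n m h]; rfl
  have y_y (n : ℤ) (x) : y n (y n x) = y n x := by
    rw [y_apply n (y n x), d_y, map_zero, sub_zero]
  have d_e (n m : ℤ) (x) : K.d n m (e n x) = 0 := by
    rw [e_apply, map_sub, d_y, hdd, sub_zero]
  have e_d (i n : ℤ) (x) : e n (K.d i n x) = 0 := by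
    by_cases h : i + 1 = n
    · obtain rfl : i = n - 1 := by omega
      rw [e_apply, y_d, hd, sub_self]
    · rw [K.shape i n h]; exact map_zero _
  refine ⟨{ e := e, h := fun p q => s q p ∘ₗ y p, d_e := d_e, e_d := fun n m x => e_d n m x,
            e_e := fun n x => ?_, homotopy := fun {p q r} hq hr x => ?_ }, ?_, ?_⟩
  · have hy : e n (y n x) = e n x := by rw [e_apply, e_apply, y_y]
    conv_lhs => rw [e_apply n x, map_sub, e_d, sub_zero, hy]
  · obtain rfl : q = p - 1 := by omega
    subst hr
    change x = e p x + (K.d (p - 1) p (s (p - 1) p (y p x)) +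
      s p (p + 1) (y (p + 1) (K.d p (p + 1) x)))
    rw [y_d, e_apply]
    generalize K.d (p - 1) p (s (p - 1) p (y p x)) = z
    rw [y_apply]
    abel
  · intro n r x
    have hy : y n (ρ n r x) = ρ n r (y n x) := by
      rw [y_apply, y_apply, hρ, hs, map_sub]
    change e n _ = ρ n r (e n x)
    rw [e_apply, e_apply, hy, hs, hρ, map_sub]
  · intro p q r x
    have hy : y p (ρ p r x) = ρ p r (y p x) := by
      rw [y_apply, y_apply, hρ, hs, map_sub]
    change s q p (y p _) = ρ q r (s q p (y p x))
    rw [hy, hs]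

/-! ### Euler characteristics -/

/-- The total cohomology of the complex is finite-dimensional. -/
def HasFiniteHomology (K : CochainComplex (ModuleCat.{u} k) ℤ) : Prop :=
  (∀ n, Module.Finite k (K.homology n)) ∧ {n | Module.finrank k (K.homology n) ≠ 0}.Finite

/-- The Euler characteristic of the cohomology; it is meaningful when `HasFiniteHomology K`. -/
noncomputable def eulerChar (K : CochainComplex (ModuleCat.{u} k) ℤ) : ℤ :=
  ∑ᶠ n : ℤ, (n.negOnePow : ℤ) * Module.finrank k (K.homology n)

theorem eulerChar_congr {K L : CochainComplex (ModuleCat.{u} k) ℤ}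
    (e : ∀ n, Nonempty (K.homology n ≅ L.homology n)) : eulerChar K = eulerChar L := by
  refine finsum_congr fun n => ?_
  obtain ⟨e⟩ := e n
  rw [e.toLinearEquiv.finrank_eq]

theorem HasFiniteHomology.congr {K L : CochainComplex (ModuleCat.{u} k) ℤ}
    (e : ∀ n, Nonempty (K.homology n ≅ L.homology n)) (h : HasFiniteHomology K) :
    HasFiniteHomology L := by
  have hf n : Module.finrank k (K.homology n) = Module.finrank k (L.homology n) := by
    obtain ⟨e⟩ := e n
    exact e.toLinearEquiv.finrank_eq
  refine ⟨fun n => ?_, ?_⟩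
  · obtain ⟨e⟩ := e n
    have := h.1 n
    exact Module.Finite.equiv e.toLinearEquiv
  · simpa only [hf] using h.2

theorem finrank_eq_add_of_exact {S : ShortComplex (ModuleCat.{u} k)} (hS : S.Exact)
    [Module.Finite k S.X₂] :
    Module.finrank k S.X₂ =
      Module.finrank k (LinearMap.range S.f.hom) + Module.finrank k (LinearMap.range S.g.hom) := by
  rw [hS.moduleCat_range_eq_ker, add_comm, LinearMap.finrank_range_add_finrank_ker]

/-- The Euler characteristic is additive, by the long exact cohomology sequence. -/
theorem eulerChar_of_shortExact {S : ShortComplex (CochainComplex (ModuleCat.{u} k) ℤ)}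
    (hS : S.ShortExact) (h₁ : HasFiniteHomology S.X₁) (h₂ : HasFiniteHomology S.X₂)
    (h₃ : HasFiniteHomology S.X₃) : eulerChar S.X₂ = eulerChar S.X₁ + eulerChar S.X₃ := by
  have := h₁.1
  have := h₂.1
  have := h₃.1
  -- The rank of the connecting map `Hⁿ(X₃) → Hⁿ⁺¹(X₁)`, which contributes to `X₁` and to `X₃` with
  -- opposite signs.
  let r (n : ℤ) := Module.finrank k (LinearMap.range (hS.δ n (n + 1) rfl).hom)
  have e₁ (n : ℤ) : Module.finrank k (S.X₁.homology n) = r (n - 1) +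
      Module.finrank k (LinearMap.range (HomologicalComplex.homologyMap S.f n).hom) := by
    obtain ⟨m, rfl⟩ : ∃ m, n = m + 1 := ⟨n - 1, by omega⟩
    rw [add_sub_cancel_right]
    exact finrank_eq_add_of_exact (hS.homology_exact₁ m (m + 1) rfl)
  have e₂ (n : ℤ) := finrank_eq_add_of_exact (hS.homology_exact₂ n)
  have e₃ (n : ℤ) := finrank_eq_add_of_exact (hS.homology_exact₃ n (n + 1) rfl)
  dsimp only at e₂ e₃
  have hr : {n | r n ≠ 0}.Finite := h₃.2.subset fun n (hn : r n ≠ 0) => by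
    change Module.finrank k (S.X₃.homology n) ≠ 0
    rw [e₃]
    change _ + r n ≠ 0
    omega
  have s (f : ℤ → ℕ) (hf : {n | f n ≠ 0}.Finite) :
      (Function.support fun n : ℤ => (n.negOnePow : ℤ) * f n).Finite :=
    hf.subset fun n hn h0 => hn (by
      change (n.negOnePow : ℤ) * f n = 0
      rw [h0]; simp)
  have shift : ∑ᶠ n : ℤ, (n.negOnePow : ℤ) * (r (n - 1) : ℤ) =
      - ∑ᶠ n : ℤ, (n.negOnePow : ℤ) * (r n : ℤ) := by
    rw [← finsum_comp_equiv (Equiv.addRight (1 : ℤ)), ← finsum_neg_distrib]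
    refine finsum_congr fun n => ?_
    simp [Int.negOnePow_succ]
  have hr' : {n | r (n - 1) ≠ 0}.Finite :=
    hr.preimage ((Equiv.subRight (1 : ℤ)).injective.injOn)
  have key : eulerChar S.X₂ + (∑ᶠ n : ℤ, (n.negOnePow : ℤ) * (r (n - 1) : ℤ) +
      ∑ᶠ n : ℤ, (n.negOnePow : ℤ) * (r n : ℤ)) = eulerChar S.X₁ + eulerChar S.X₃ := by
    unfold eulerChar
    rw [← finsum_add_distrib (s _ hr') (s _ hr), ← finsum_add_distrib (s _ h₁.2) (s _ h₃.2),
      ← finsum_add_distrib (s _ h₂.2)]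
    · refine finsum_congr fun n => ?_
      rw [e₁, e₂, e₃]
      push_cast
      ring
    · exact (((s _ hr').union (s _ hr))).subset (Function.support_add _ _)
  rw [← key, shift]
  ring

/-! ### The derived category of a semisimple algebra -/

namespace DGMod

section General

variable {B : DGCat k}

/-- The complex `M(w)` as a functor of `M`. -/
abbrev evalFunctor (w : B.Obj) : DGMod B ⥤ CochainComplex (ModuleCat.{u} k) ℤ where
  obj M := M.obj w
  map f := DGMod.Hom.app f w
  map_id _ := rfl
  map_comp _ _ := rfl

/-- The cohomology of the complex `M(w)`, as a functor on the derived category. -/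
noncomputable def homologyFunctor (w : B.Obj) (n : ℤ) : Derived B ⥤ ModuleCat.{u} k :=
  Localization.Construction.lift
    (evalFunctor w ⋙ HomologicalComplex.homologyFunctor (ModuleCat.{u} k) (ComplexShape.up ℤ) n)
    (fun M N f (hf : ∀ w, QuasiIso (DGMod.Hom.app f w)) => by
      have := hf w
      change IsIso (HomologicalComplex.homologyMap (DGMod.Hom.app f w) n)
      infer_instance)

theorem isIso_Q_map {M N : DGMod B} (f : M ⟶ N) (hf : quasiIso B f) :
    IsIso ((quasiIso B).Q.map f) := (quasiIso B).Q_inverts f hf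

/-- A morphism of dg modules which is bijective in all degrees is an isomorphism. -/
theorem isIso_of_bijective {M N : DGMod B} (f : M ⟶ N)
    (hf : ∀ w n, Function.Bijective ((DGMod.Hom.app f w).f n)) : IsIso f := by
  have hiso (w) : IsIso (DGMod.Hom.app f w) := by
    have (n : ℤ) : IsIso ((DGMod.Hom.app f w).f n) :=
      (ConcreteCategory.isIso_iff_bijective _).2 (hf w n)
    exact HomologicalComplex.Hom.isIso_of_components _
  have hinv (w : B.Obj) (n : ℤ) (x : (M.obj w).X n) :
      (inv (DGMod.Hom.app f w)).f n ((DGMod.Hom.app f w).f n x) = x := by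
    rw [← ModuleCat.comp_apply, ← HomologicalComplex.comp_f, IsIso.hom_inv_id]
    rfl
  have hinv' (w : B.Obj) (n : ℤ) (x : (N.obj w).X n) :
      (DGMod.Hom.app f w).f n ((inv (DGMod.Hom.app f w)).f n x) = x := by
    rw [← ModuleCat.comp_apply, ← HomologicalComplex.comp_f, IsIso.inv_hom_id]
    rfl
  refine ⟨{ app := fun w => inv (DGMod.Hom.app f w), app_act := fun {w w' p q n} h m b => ?_ :
    DGMod.Hom N M }, ?_, ?_⟩
  · apply (hf w' n).1
    rw [hinv', DGMod.Hom.app_act, hinv']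
  · apply DGMod.Hom.ext
    funext w
    exact IsIso.hom_inv_id (DGMod.Hom.app f w)
  · apply DGMod.Hom.ext
    funext w
    exact IsIso.inv_hom_id (DGMod.Hom.app f w)

theorem homologyMap_eq_of_Q_map_eq {M N : DGMod B} {f g : M ⟶ N}
    (h : (quasiIso B).Q.map f = (quasiIso B).Q.map g) (w : B.Obj) (n : ℤ) :
    HomologicalComplex.homologyMap (DGMod.Hom.app f w) n =
      HomologicalComplex.homologyMap (DGMod.Hom.app g w) n :=
  congrArg (homologyFunctor w n).map h

/-- All differentials of the dg module vanish. -/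
def IsMinimal (X : DGMod B) : Prop := ∀ w n m, (X.obj w).d n m = 0

theorem IsMinimal.eq_of_Q_map_eq {X Y : DGMod B} (hX : X.IsMinimal) (hY : Y.IsMinimal) {f g : X ⟶ Y}
    (h : (quasiIso B).Q.map f = (quasiIso B).Q.map g) : f = g := by
  apply DGMod.Hom.ext
  funext w
  exact ext_of_homologyMap (hX w) (hY w) (homologyMap_eq_of_Q_map_eq h w)

theorem IsMinimal.isIso_of_quasiIso {X Y : DGMod B} (hX : X.IsMinimal) (hY : Y.IsMinimal)
    {f : X ⟶ Y} (hf : quasiIso B f) : IsIso f :=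
  isIso_of_bijective f fun w n => by
    have := hf w
    exact bijective_of_quasiIso (hX w) (hY w) (DGMod.Hom.app f w) n

variable (B) in
/-- Every dg module is quasi-isomorphic, by morphisms in both directions, to one with zero
differential. -/
def HasMinimalModels : Prop :=
  ∀ M : DGMod B, ∃ (X : DGMod B) (a : X ⟶ M) (b : M ⟶ X), X.IsMinimal ∧ a ≫ b = 𝟙 X ∧
    quasiIso B a ∧ quasiIso B b

/-- If minimal models exist, then all morphisms of the derived category come from morphisms of dg
modules: the inverse of a quasi-isomorphism `s` is represented by the inverse of the isomorphism
induced by `s` on the minimal models. -/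
theorem HasMinimalModels.full_Q (hB : HasMinimalModels B) : (quasiIso B).Q.Full := by
  let P : MorphismProperty (Derived B) := fun X Y φ =>
    ∃ (M N : DGMod B) (hM : (quasiIso _).Q.obj M = X)
      (hN : (quasiIso _).Q.obj N = Y) (f : M ⟶ N),
      φ = eqToHom hM.symm ≫ (quasiIso _).Q.map f ≫ eqToHom hN
  have : P.IsStableUnderComposition := ⟨by
    rintro X Y Z _ _ ⟨M, N, rfl, rfl, f, rfl⟩ ⟨N', L, hN, rfl, g, rfl⟩
    obtain rfl : N' = N := (Localization.Construction.objEquiv (quasiIso _)).injective hN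
    exact ⟨_, _, rfl, rfl, f ≫ g, by simp⟩⟩
  have hP : P = ⊤ := by
    refine Localization.Construction.morphismProperty_eq_top P
      (fun M N f => ⟨M, N, rfl, rfl, f, by simp⟩) fun M N s hs => ?_
    obtain ⟨X, a, b, hX, -, ha, -⟩ := hB M
    obtain ⟨Y, c, d, hY, -, -, hd⟩ := hB N
    have : IsIso (a ≫ s ≫ d) := hX.isIso_of_quasiIso hY fun w => by
      have := ha w
      have := hs w
      have := hd w
      exact inferInstanceAs
        (QuasiIso (DGMod.Hom.app a w ≫ DGMod.Hom.app s w ≫ DGMod.Hom.app d w))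
    have := isIso_Q_map _ ha
    refine ⟨N, M, rfl, rfl, d ≫ inv (a ≫ s ≫ d) ≫ a, ?_⟩
    change (Localization.Construction.wIso s hs).inv = _
    have := isIso_Q_map _ hs
    rw [← cancel_epi ((quasiIso _).Q.map s)]
    refine (Localization.Construction.wIso s hs).hom_inv_id.trans ?_
    rw [← cancel_epi ((quasiIso _).Q.map a)]
    have e : (quasiIso _).Q.map a ≫ (quasiIso _).Q.map s ≫
        (quasiIso _).Q.map (d ≫ inv (a ≫ s ≫ d) ≫ a) = (quasiIso _).Q.map a := by
      have h : a ≫ s ≫ d ≫ inv (a ≫ s ≫ d) ≫ a = a := by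
        have := congrArg (· ≫ a) (IsIso.hom_inv_id (a ≫ s ≫ d))
        simpa only [Category.assoc, Category.id_comp] using this
      simp only [← Functor.map_comp]
      rw [h]
    simpa using e.symm
  refine ⟨fun {M N} φ => ?_⟩
  obtain ⟨M', N', hM, hN, f, rfl⟩ : P φ := hP ▸ trivial
  obtain rfl : M' = M := (Localization.Construction.objEquiv (quasiIso _)).injective hM
  obtain rfl : N' = N := (Localization.Construction.objEquiv (quasiIso _)).injective hN
  exact ⟨f, by simp⟩

end General

variable {B : Type u} [Ring B] [Algebra k B]

/-- The underlying complex of a dg module over an algebra. -/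
abbrev cx (M : DGMod (DGCat.ofAlgebra k B)) : CochainComplex (ModuleCat.{u} k) ℤ :=
  M.obj PUnit.unit

variable (B) in
/-- An element of an algebra as a homogeneous element of degree `0`. -/
abbrev degreeZero (k : Type u) [Field k] [Algebra k B] (b : B) : algDegree k B 0 :=
  ⟨b, fun h => absurd rfl h⟩

variable (M : DGMod (DGCat.ofAlgebra k B))

/-- The action in degree `n` of a dg module over an algebra concentrated in degree `0`. -/
def rightAct (n : ℤ) : Bᵐᵒᵖ →ₐ[k] Module.End k (M.cx.X n) :=
  AlgHom.ofLinearMap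
    { toFun := fun b => (M.act (w' := PUnit.unit) (add_zero n)).flip (degreeZero B k b.unop)
      map_add' := fun a b => LinearMap.map_add (M.act (w' := PUnit.unit) (add_zero n)).flip
        (degreeZero B k a.unop) (degreeZero B k b.unop)
      map_smul' := fun c b => LinearMap.map_smul (M.act (w' := PUnit.unit) (add_zero n)).flip c
        (degreeZero B k b.unop) }
    (by ext m; exact M.act_one m)
    (fun a b => by
      ext m
      exact (M.act_act (w' := PUnit.unit) (w'' := PUnit.unit) (add_zero n) (add_zero 0)
        (add_zero n) (add_zero n) m (degreeZero B k b.unop) (degreeZero B k a.unop)).symm)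

theorem d_rightAct (n m : ℤ) (b : Bᵐᵒᵖ) (x : M.cx.X n) :
    M.cx.d n m (M.rightAct n b x) = M.rightAct m b (M.cx.d n m x) := by
  by_cases h : n + 1 = m
  · have := M.d_act (w' := PUnit.unit) (add_zero n) h (zero_add 1) h x (degreeZero B k b.unop)
    refine this.trans ?_
    have h0 : (algComplex k B).d 0 1 (degreeZero B k b.unop) = 0 := rfl
    change _ + n.negOnePow • M.act (w' := PUnit.unit) h x ((algComplex k B).d 0 1 _) = _
    rw [h0, map_zero, smul_zero, add_zero]
    rfl
  · rw [M.cx.shape n m h]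
    exact (map_zero (M.rightAct m b)).symm

/-- A family of linear maps commutes with the whole action once it commutes with `rightAct`. -/
theorem map_act_of_map_rightAct {M N : DGMod (DGCat.ofAlgebra k B)} {r : ℤ}
    (f : ∀ p q, p + r = q → (M.cx.X p →ₗ[k] N.cx.X q))
    (hf : ∀ p q h b x, f p q h (M.rightAct p b x) = N.rightAct q b (f p q h x))
    {w w' : PUnit} {p q n p' n' : ℤ} (h : p + q = n) (hp : p + r = p') (hn : n + r = n')
    (h' : p' + q = n') (m : (M.obj w).X p) (b : ((DGCat.ofAlgebra k B).Hom w' w).X q) :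
    f n n' hn (M.act h m b) = N.act h' (f p p' hp m) b := by
  by_cases hq : q = 0
  · subst hq
    obtain rfl : p = n := by omega
    obtain rfl : p' = n' := by omega
    exact hf p p' hp (MulOpposite.op (b : algDegree k B 0).1) m
  · have hb : b = 0 := Subtype.ext ((b : algDegree k B q).2 hq)
    rw [hb, map_zero, map_zero, map_zero]

/-- A chain map commuting with `rightAct` is a morphism of dg modules. -/
def homOfRightAct {M N : DGMod (DGCat.ofAlgebra k B)} (f : M.cx ⟶ N.cx)
    (hf : ∀ n b x, f.f n (M.rightAct n b x) = N.rightAct n b (f.f n x)) : M ⟶ N :=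
  { app := fun _ => f
    app_act := fun {w w' p q n} h m b =>
      map_act_of_map_rightAct (M := M) (N := N) (r := 0)
        (fun p q h => (eqToHom (by rw [← h, add_zero]) ≫ f.f q).hom)
        (fun p q h b x => by
          obtain rfl : p = q := by omega
          exact hf p b x) h (add_zero p) (add_zero n) h m b : DGMod.Hom M N }

section Harmonic

variable {M} (H : Harmonic M.cx) (hH : ∀ n b x, H.e n (M.rightAct n b x) = M.rightAct n b (H.e n x))

include hH in
theorem e_act {w w' : PUnit} {p q n : ℤ} (h : p + q = n) (m : (M.obj w).X p)
    (b : ((DGCat.ofAlgebra k B).Hom w' w).X q) : H.e n (M.act h m b) = M.act h (H.e p m) b :=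
  map_act_of_map_rightAct (M := M) (N := M) (r := 0)
    (fun p q h => H.e q ∘ₗ (eqToHom (by rw [← h, add_zero]) : M.cx.X p ⟶ M.cx.X q).hom)
    (fun p q h b x => by
      obtain rfl : p = q := by omega
      exact hH p b x) h (add_zero p) (add_zero n) h m b

/-- The dg module of harmonic elements. -/
abbrev harmonic : DGMod (DGCat.ofAlgebra k B) where
  obj _ := H.complex
  act {w w' p q n} h := LinearMap.mk₂ k
    (fun (m : LinearMap.range (H.e p)) (b : algDegree k B q) =>
      (⟨M.act (w := w) (w' := w') h m.1 b, M.act (w := w) (w' := w') h m.1 b, by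
        rw [e_act H hH, H.e_coe]⟩ : LinearMap.range (H.e n)))
    (fun m m' b => Subtype.ext (LinearMap.map_add₂ (M.act (w := w) (w' := w') h) m.1 m'.1 b))
    (fun c m b => Subtype.ext (LinearMap.map_smul₂ (M.act (w := w) (w' := w') h) c m.1 b))
    (fun m b b' => Subtype.ext (map_add (M.act (w := w) (w' := w') h m.1) b b'))
    (fun c m b => Subtype.ext (map_smul (M.act (w := w) (w' := w') h m.1) c b))
  act_one m := Subtype.ext (M.act_one _)
  act_act hs ht hsn htn m b c := Subtype.ext (M.act_act hs ht hsn htn _ b c)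
  d_act {w w' p q n p' q' n'} h hp hq hn m b := by
    change (0 : LinearMap.range (H.e n')) =
      (⟨M.act (w := w) (w' := w') _ (0 : M.cx.X p') b, _⟩ : LinearMap.range (H.e n')) +
      p.negOnePow • ⟨M.act (w := w) (w' := w') _ m.1 (0 : algDegree k B q'), _⟩
    apply Subtype.ext
    change (0 : M.cx.X n') = M.act (w := w) (w' := w') _ (0 : M.cx.X p') b +
      p.negOnePow • M.act (w := w) (w' := w') _ m.1 (0 : algDegree k B q')
    rw [(M.act (w := w) (w' := w') _).map_zero₂, (M.act (w := w) (w' := w') _ m.1).map_zero,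
      smul_zero, add_zero]

/-- The inclusion of the harmonic elements, as a morphism of dg modules. -/
def harmonicι : harmonic H hH ⟶ M :=
  { app := fun _ => H.ι, app_act := fun _ _ _ => rfl : DGMod.Hom (harmonic H hH) M }

/-- The projection to the harmonic elements, as a morphism of dg modules. -/
def harmonicπ : M ⟶ harmonic H hH :=
  { app := fun _ => H.π
    app_act := fun h m b => Subtype.ext (e_act H hH h m b) : DGMod.Hom M (harmonic H hH) }

theorem quasiIso_harmonicι : quasiIso _ (harmonicι H hH) :=
  fun _ => inferInstanceAs (QuasiIso H.ι)

theorem quasiIso_harmonicπ : quasiIso _ (harmonicπ H hH) :=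
  fun _ => inferInstanceAs (QuasiIso H.π)

end Harmonic

/-- Over a semisimple algebra, every dg module has a zero-differential model. -/
theorem hasMinimalModels_ofAlgebra [IsSemisimpleRing B] :
    HasMinimalModels (DGCat.ofAlgebra k B) := fun M => by
  obtain ⟨H, hH, -⟩ := exists_equivariant_harmonic M.cx M.rightAct M.d_rightAct
  refine ⟨harmonic H hH, harmonicι H hH, harmonicπ H hH, fun _ _ _ => rfl, ?_,
    quasiIso_harmonicι H hH, quasiIso_harmonicπ H hH⟩
  apply DGMod.Hom.ext
  funext _
  exact H.ι_π

end DGMod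

/-! ### Coproducts and compact objects -/

namespace DGMod

section DirectSum

variable {B : DGCat k} {ι : Type u} (N : ι → DGMod B)

/-- The direct sum of dg modules. -/
abbrev directSum : DGMod B where
  obj w :=
    { X := fun n => ModuleCat.of k (Π₀ i, ((N i).obj w).X n)
      d := fun n m => ModuleCat.ofHom
        (DFinsupp.mapRange.linearMap fun i => (((N i).obj w).d n m).hom)
      shape := fun n m h => by
        ext x i
        exact congrArg (fun f : ((N i).obj w).X n ⟶ ((N i).obj w).X m => f (x i))
          (((N i).obj w).shape n m h)
      d_comp_d' := fun n m l _ _ => by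
        ext x i
        exact congrArg (fun f : ((N i).obj w).X n ⟶ ((N i).obj w).X l => f (x i))
          (((N i).obj w).d_comp_d n m l) }
  act {w w' p q n} h := LinearMap.mk₂ k
    (fun (m : Π₀ i, ((N i).obj w).X p) (b : (B.Hom w' w).X q) =>
      (DFinsupp.mapRange.linearMap (fun i => ((N i).act h).flip b) m : Π₀ i, ((N i).obj w').X n))
    (fun m m' b => map_add _ _ _)
    (fun c m b => map_smul _ _ _)
    (fun m b b' => by
      ext i
      exact map_add ((N i).act h (m i)) b b')
    (fun c m b => by
      ext i
      exact map_smul ((N i).act h (m i)) c b)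
  act_one {w n} m := by
    refine DFinsupp.ext (β := fun i => ((N i).obj w).X n) fun i => ?_
    exact (N i).act_one _
  act_act {w w' w'' p q r s t n} hs ht hsn htn m b c := by
    refine DFinsupp.ext (β := fun i => ((N i).obj w'').X n) fun i => ?_
    exact (N i).act_act hs ht hsn htn _ b c
  d_act {w w' p q n p' q' n'} h hp hq hn m b := by
    refine DFinsupp.ext (β := fun i => ((N i).obj w').X n') fun i => ?_
    exact (N i).d_act h hp hq hn (DFunLike.coe (F := Π₀ i, ((N i).obj w).X p) m i) b

variable {N}

open Classical in
/-- The inclusion of a summand. -/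
noncomputable def directSumι (i : ι) : N i ⟶ directSum N :=
  { app := fun w =>
      { f := fun n => ModuleCat.ofHom
          (DFinsupp.lsingle (R := k) (M := fun i => ((N i).obj w).X n) i)
        comm' := fun n m _ => by
          refine ModuleCat.hom_ext (LinearMap.ext fun x => ?_)
          exact DFinsupp.mapRange_single (f := fun i => ((N i).obj w).d n m)
            (hf := fun i => map_zero _) (i := i) (b := x) }
    app_act := fun {w w' p q n} h m b =>
      (DFinsupp.mapRange_single (f := fun i => ((N i).act h).flip b)
        (hf := fun i => map_zero _) (i := i) (b := m)).symm : DGMod.Hom (N i) (directSum N) }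

theorem directSum_induction {w : B.Obj} {n : ℤ} {p : ((directSum N).obj w).X n → Prop}
    (h0 : p 0) (hadd : ∀ x y, p x → p y → p (x + y))
    (hι : ∀ i x, p ((DGMod.Hom.app (directSumι (N := N) i) w).f n x)) (x) : p x := by
  classical
  exact DFinsupp.induction (β := fun i => ((N i).obj w).X n) x h0
    fun i b f _ _ hf => hadd _ _ (hι i b) hf

theorem directSum_hom_ext {L : DGMod B} {f g : directSum N ⟶ L}
    (h : ∀ i, directSumι i ≫ f = directSumι i ≫ g) : f = g := by
  apply DGMod.Hom.ext
  funext w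
  ext n x
  change (DGMod.Hom.app f w).f n x = (DGMod.Hom.app g w).f n x
  induction x using directSum_induction with
  | h0 => simp only [map_zero]
  | hadd x y hx hy => simp only [map_add, hx, hy]
  | hι i x =>
    exact congrArg (fun φ : N i ⟶ L => (DGMod.Hom.app φ w).f n x) (h i)

open Classical in
/-- The morphism out of a direct sum with given components. -/
noncomputable def directSumDesc {L : DGMod B} (f : ∀ i, N i ⟶ L) : directSum N ⟶ L :=
  have key (w : B.Obj) (n : ℤ) (i : ι) (x : ((N i).obj w).X n) :
      DFinsupp.lsum ℕ (fun i => ((DGMod.Hom.app (f i) w).f n).hom) (DFinsupp.single i x) =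
        (DGMod.Hom.app (f i) w).f n x := DFinsupp.lsum_single ..
  { app := fun w =>
      { f := fun n => ModuleCat.ofHom (DFinsupp.lsum ℕ (fun i => ((DGMod.Hom.app (f i) w).f n).hom))
        comm' := fun n m _ => by
          refine ModuleCat.hom_ext (LinearMap.ext fun x => ?_)
          induction x using directSum_induction with
          | h0 => rw [map_zero, map_zero]
          | hadd x y hx hy => rw [map_add, map_add, hx, hy]
          | hι i x =>
            have h1 : ((directSum N).obj w).d n m
                ((DGMod.Hom.app (directSumι (N := N) i) w).f n x) =
                (DGMod.Hom.app (directSumι (N := N) i) w).f m (((N i).obj w).d n m x) :=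
              congrArg (fun φ : ((N i).obj w).X n ⟶ ((directSum N).obj w).X m => φ x)
                ((DGMod.Hom.app (directSumι (N := N) i) w).comm n m)
            have h2 : (L.obj w).d n m ((DGMod.Hom.app (f i) w).f n x) =
                (DGMod.Hom.app (f i) w).f m (((N i).obj w).d n m x) :=
              congrArg (fun φ : ((N i).obj w).X n ⟶ (L.obj w).X m => φ x)
                ((DGMod.Hom.app (f i) w).comm n m)
            exact ((congrArg ((L.obj w).d n m) (key w n i x)).trans h2).trans
              ((congrArg (DFinsupp.lsum ℕ (fun i => ((DGMod.Hom.app (f i) w).f m).hom)) h1).trans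
                (key w m i _)).symm }
    app_act := fun {w w' p q n} h m b => by
      change DFinsupp.lsum ℕ (fun i => ((DGMod.Hom.app (f i) w').f n).hom)
        ((directSum N).act h m b) =
          L.act h (DFinsupp.lsum ℕ (fun i => ((DGMod.Hom.app (f i) w).f p).hom) m) b
      induction m using directSum_induction with
      | h0 => rw [LinearMap.map_zero₂, map_zero, map_zero, LinearMap.map_zero₂]
      | hadd x y hx hy =>
        rw [LinearMap.map_add₂, map_add, map_add, LinearMap.map_add₂, hx, hy]
      | hι i x =>
        rw [← (directSumι (N := N) i).app_act]
        refine (key w' n i ((N i).act h x b)).trans ?_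
        rw [DGMod.Hom.app_act]
        exact congrArg (fun y => L.act h y b) (key w p i x).symm :
    DGMod.Hom (directSum N) L }

open Classical in
theorem directSumι_desc {L : DGMod B} (f : ∀ i, N i ⟶ L) (i : ι) :
    directSumι i ≫ directSumDesc f = f i := by
  apply DGMod.Hom.ext
  funext w
  ext n x
  exact DFinsupp.lsum_single (M := fun i => ((N i).obj w).X n) (R := k)
    (N := (L.obj w).X n) ℕ (fun i => ((DGMod.Hom.app (f i) w).f n).hom) i x

open Classical in
/-- The restriction to a part of the summands. -/
noncomputable def directSumRestrict (s : Finset ι) :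
    directSum N ⟶ directSum fun i : s => N i :=
  { app := fun w =>
      { f := fun n => ModuleCat.ofHom (DFinsupp.subtypeDomainLinearMap k
          (fun i => ((N i).obj w).X n) (fun i => i ∈ s))
        comm' := fun n m _ => by
          refine ModuleCat.hom_ext (LinearMap.ext fun x => ?_)
          refine DFinsupp.ext (β := fun i : s => ((N i).obj w).X m) fun i => ?_
          rfl }
    app_act := fun {w w' p q n} h m b => by
      refine DFinsupp.ext (β := fun i : s => ((N i).obj w').X n) fun i => ?_
      rfl : DGMod.Hom (directSum N) (directSum fun i : s => N i) }

/-- The inclusion of a part of the summands. -/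
noncomputable def directSumExtend (s : Finset ι) :
    directSum (fun i : s => N i) ⟶ directSum N := directSumDesc fun i : s => directSumι i.1

/-- Finitely many elements of a direct sum lie in a finite part of it. -/
theorem exists_directSumExtend_restrict (w : B.Obj) (n : ℤ) (x : ((directSum N).obj w).X n) :
    ∃ s : Finset ι, ∀ t, s ⊆ t → (DGMod.Hom.app (directSumExtend (N := N) t) w).f n
      ((DGMod.Hom.app (directSumRestrict (N := N) t) w).f n x) = x := by
  induction x using directSum_induction with
  | h0 => exact ⟨∅, fun t _ => by rw [map_zero, map_zero]⟩
  | hadd x y hx hy =>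
    obtain ⟨s, hs⟩ := hx
    obtain ⟨s', hs'⟩ := hy
    classical
    exact ⟨s ∪ s', fun t ht => by
      rw [map_add, map_add, hs t (Finset.union_subset_left ht),
        hs' t (Finset.union_subset_right ht)]⟩
  | hι i x =>
    refine ⟨{i}, fun t ht => ?_⟩
    have hi : i ∈ t := ht (Finset.mem_singleton_self i)
    have h1 : (DGMod.Hom.app (directSumRestrict (N := N) t) w).f n
        ((DGMod.Hom.app (directSumι (N := N) i) w).f n x) =
          (DGMod.Hom.app (directSumι (N := fun i : t => N i) ⟨i, hi⟩) w).f n x := by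
      refine DFinsupp.ext (β := fun i : t => ((N i).obj w).X n) fun j => ?_
      let _ : DecidableEq ι := fun _ _ => Classical.propDecidable _
      let _ : DecidableEq t := fun _ _ => Classical.propDecidable _
      change @DFinsupp.single ι (fun i => ((N i).obj w).X n) _
        (fun _ _ => Classical.propDecidable _) i x j.1 =
        @DFinsupp.single t (fun i => ((N i).obj w).X n) _
          (fun _ _ => Classical.propDecidable _) ⟨i, hi⟩ x j
      by_cases hj : (⟨i, hi⟩ : t) = j
      · subst hj
        rw [DFinsupp.single_eq_same, DFinsupp.single_eq_same]
      · rw [DFinsupp.single_eq_of_ne, DFinsupp.single_eq_of_ne]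
        · exact fun h => hj h.symm
        · exact fun h => hj (Subtype.ext h.symm)
    rw [h1]
    exact congrArg (fun φ : N i ⟶ directSum N => (DGMod.Hom.app φ w).f n x)
      (directSumι_desc (N := fun i : t => N i) (fun i : t => directSumι i.1) ⟨i, hi⟩)

end DirectSum

end DGMod

namespace DGMod

variable {B : DGCat k}

section Coproduct

variable {ι : Type u} {N X : ι → DGMod B}

/-- A candidate for the coproduct of `N i` in the derived category: the direct sum of minimal
models `X i`. -/
noncomputable abbrev modelCofan (b : ∀ i, N i ⟶ X i) : Cofan fun i => (quasiIso B).Q.obj (N i) :=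
  Cofan.mk ((quasiIso B).Q.obj (directSum X)) fun i => (quasiIso B).Q.map (b i ≫ directSumι i)

/-- If minimal models exist, then direct sums of them are coproducts in the derived category. -/
theorem HasMinimalModels.nonempty_isColimit_modelCofan (hB : HasMinimalModels B)
    (hX : ∀ i, (X i).IsMinimal) (a : ∀ i, X i ⟶ N i) (b : ∀ i, N i ⟶ X i)
    (hab : ∀ i, a i ≫ b i = 𝟙 _) (hb : ∀ i, quasiIso B (b i)) :
    Nonempty (IsColimit (modelCofan b)) := by
  have := hB.full_Q
  have hQb (i) := isIso_Q_map _ (hb i)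
  have hba (i : ι) : (quasiIso B).Q.map (b i) ≫ (quasiIso B).Q.map (a i) = 𝟙 _ := by
    have h : (quasiIso B).Q.map (a i) ≫ (quasiIso B).Q.map (b i) = 𝟙 _ := by
      rw [← Functor.map_comp, hab, CategoryTheory.Functor.map_id]
    rw [← cancel_mono ((quasiIso B).Q.map (b i)), Category.assoc, h, Category.comp_id,
      Category.id_comp]
  have obj (s : Cofan fun i => (quasiIso B).Q.obj (N i)) :
      ∃ L : DGMod B, (quasiIso B).Q.obj L = s.pt :=
    (Localization.Construction.objEquiv (quasiIso B)).surjective s.pt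
  have desc (s : Cofan fun i => (quasiIso B).Q.obj (N i)) :
      ∃ f : (modelCofan b).pt ⟶ s.pt, ∀ i, (modelCofan b).inj i ≫ f = s.inj i := by
    obtain ⟨L, hL⟩ := obj s
    let g (i) : X i ⟶ L := (quasiIso B).Q.preimage
      ((quasiIso B).Q.map (a i) ≫ s.inj i ≫ eqToHom hL.symm)
    refine ⟨(quasiIso B).Q.map (directSumDesc g) ≫ eqToHom hL, fun i => ?_⟩
    change (quasiIso B).Q.map _ ≫ _ = _
    rw [← Category.assoc, ← Functor.map_comp, Category.assoc, directSumι_desc, Functor.map_comp,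
      Functor.map_preimage, ← Category.assoc ((quasiIso B).Q.map (b i)), hba]
    simp
  have uniq (s : Cofan fun i => (quasiIso B).Q.obj (N i)) (f g : (modelCofan b).pt ⟶ s.pt)
      (hfg : ∀ i, (modelCofan b).inj i ≫ f = (modelCofan b).inj i ≫ g) : f = g := by
    obtain ⟨L, hL⟩ := obj s
    rw [← cancel_mono (eqToHom hL.symm)]
    obtain ⟨f', hf'⟩ := (quasiIso B).Q.map_surjective (f ≫ eqToHom hL.symm)
    obtain ⟨g', hg'⟩ := (quasiIso B).Q.map_surjective (g ≫ eqToHom hL.symm)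
    rw [← hf', ← hg']
    obtain ⟨Y, c, d, hY, -, -, hd⟩ := hB L
    have := isIso_Q_map _ hd
    rw [← cancel_mono ((quasiIso B).Q.map d), ← Functor.map_comp, ← Functor.map_comp]
    refine congrArg _ (directSum_hom_ext fun i => (hX i).eq_of_Q_map_eq hY ?_)
    rw [← cancel_epi ((quasiIso B).Q.map (b i))]
    have e := congrArg (· ≫ eqToHom hL.symm ≫ (quasiIso B).Q.map d) (hfg i)
    simp only [Category.assoc] at e
    rw [← Category.assoc f, ← hf', ← Category.assoc g, ← hg'] at e
    simpa using e
  choose d hd using desc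
  exact ⟨Cofan.IsColimit.mk _ d hd fun s m hm => uniq s m (d s) fun j => (hm j).trans (hd s j).symm⟩

end Coproduct

section Compact

/-- The components of the dg module are finite-dimensional, and almost all of them vanish. -/
def IsTotallyFinite (M : DGMod B) : Prop :=
  (∀ w n, Module.Finite k ((M.obj w).X n)) ∧
    ∃ F : Finset (B.Obj × ℤ), ∀ w n, (w, n) ∉ F → Subsingleton ((M.obj w).X n)

variable {M : DGMod B}

/-- A morphism from a totally finite dg module to a direct sum factors through a finite part. -/
theorem IsTotallyFinite.exists_comp_restrict (hM : M.IsTotallyFinite) {ι : Type u}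
    {N : ι → DGMod B} (g : M ⟶ directSum N) :
    ∃ s : Finset ι, g = (g ≫ directSumRestrict s) ≫ directSumExtend s := by
  classical
  obtain ⟨hf, F, hF⟩ := hM
  let b (w : B.Obj) (n : ℤ) := Module.finBasis k ((M.obj w).X n)
  choose s hs using fun w n => exists_directSumExtend_restrict (N := N) w n
  let t : Finset ι := F.biUnion fun v => Finset.univ.biUnion fun i =>
    s v.1 v.2 ((DGMod.Hom.app g v.1).f v.2 (b v.1 v.2 i))
  refine ⟨t, ?_⟩
  apply DGMod.Hom.ext
  funext w
  refine HomologicalComplex.hom_ext _ _ fun n => ?_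
  by_cases hn : (w, n) ∈ F
  · refine ModuleCat.hom_ext ((b w n).ext fun i => ?_)
    refine (hs w n _ t ?_).symm
    intro x hx
    simp only [t, Finset.mem_biUnion]
    exact ⟨(w, n), hn, i, Finset.mem_univ i, hx⟩
  · have := hF w n hn
    refine ModuleCat.hom_ext (LinearMap.ext fun x => ?_)
    rw [Subsingleton.elim (α := (M.obj w).X n) x 0]
    simp only [map_zero]

/-- A morphism in the derived category from `M` to a coproduct comes from a morphism to the direct
sum of minimal models, and this one factors through a finite part. -/
theorem IsTotallyFinite.isCompact (hB : HasMinimalModels B) (hM : M.IsTotallyFinite) :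
    M.IsCompact := by
  intro ι Y c ⟨hc⟩ f
  have := hB.full_Q
  obtain ⟨N, rfl⟩ : ∃ N : ι → DGMod B, (fun i => (quasiIso B).Q.obj (N i)) = Y := by
    choose N hN using fun i =>
      (Localization.Construction.objEquiv (quasiIso B)).surjective (Y i)
    exact ⟨N, funext hN⟩
  choose X a b hX hab ha hb using fun i => hB (N i)
  obtain ⟨hc₀⟩ := hB.nonempty_isColimit_modelCofan hX a b hab hb
  obtain ⟨e, he⟩ : ∃ e : c.pt ≅ (modelCofan b).pt, ∀ i, c.inj i ≫ e.hom = (modelCofan b).inj i :=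
    ⟨hc.coconePointUniqueUpToIso hc₀, fun i => hc.comp_coconePointUniqueUpToIso_hom hc₀ ⟨i⟩⟩
  obtain ⟨g, hg⟩ := (quasiIso B).Q.map_surjective (f ≫ e.hom)
  obtain ⟨s, hs⟩ := hM.exists_comp_restrict g
  obtain ⟨hc'⟩ := hB.nonempty_isColimit_modelCofan (fun i : s => hX i) (fun i : s => a i)
    (fun i : s => b i) (fun i => hab i) (fun i => hb i)
  have key : (quasiIso B).Q.map (directSumExtend (N := X) s) =
      Cofan.IsColimit.desc hc' (fun i => c.inj i) ≫ e.hom := by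
    refine Cofan.IsColimit.hom_ext hc' _ _ fun i => ?_
    rw [← Category.assoc, Cofan.IsColimit.fac, he]
    change (quasiIso B).Q.map _ ≫ _ = (quasiIso B).Q.map _
    rw [← Functor.map_comp, Category.assoc]
    exact congrArg _ (congrArg (b i ≫ ·)
      (directSumι_desc (N := fun i : s => X i) (fun i : s => directSumι i.1) i))
  refine ⟨s, _, hc', (quasiIso B).Q.map (g ≫ directSumRestrict s), ?_⟩
  rw [← cancel_mono e.hom, Category.assoc, ← key, ← Functor.map_comp, ← hs, hg]

theorem isMinimal_directSum {ι : Type u} {N : ι → DGMod B} (hN : ∀ i, (N i).IsMinimal) :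
    (directSum N).IsMinimal := fun w n m => by
  refine ModuleCat.hom_ext (LinearMap.ext fun x => ?_)
  refine DFinsupp.ext (β := fun i => ((N i).obj w).X m) fun i => ?_
  exact congrArg (fun f : ((N i).obj w).X n ⟶ ((N i).obj w).X m =>
    f (DFunLike.coe (F := Π₀ i, ((N i).obj w).X n) x i)) (hN i w n m)

/-- If a minimal model of a compact dg module is a direct summand of a direct sum, then its
cohomology embeds into a finite part of this direct sum. -/
theorem HasMinimalModels.exists_injective_of_isCompact (hB : HasMinimalModels B)
    (hM : M.IsCompact) {X : DGMod B} (a : X ⟶ M) (b : M ⟶ X) (hab : a ≫ b = 𝟙 X)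
    (hb : quasiIso B b) {ι : Type u} {G : ι → DGMod B} (hG : ∀ i, (G i).IsMinimal)
    (τ : X ⟶ directSum G) (σ : directSum G ⟶ X) (hτσ : τ ≫ σ = 𝟙 X) :
    ∃ s : Finset ι, ∀ w n, ∃ φ : (M.obj w).homology n →ₗ[k] (Π₀ i : s, ((G i).obj w).X n),
      Function.Injective φ := by
  have id_quasiIso (i : ι) : quasiIso B (𝟙 (G i)) := fun w =>
    inferInstanceAs (QuasiIso (𝟙 ((G i).obj w)))
  obtain ⟨hc⟩ := hB.nonempty_isColimit_modelCofan hG (fun i => 𝟙 _) (fun i => 𝟙 _)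
    (fun i => Category.id_comp _) id_quasiIso
  obtain ⟨s, c', hc', g, hg⟩ := hM ι _ _ ⟨hc⟩ ((quasiIso B).Q.map (b ≫ τ))
  refine ⟨s, fun w n => ?_⟩
  obtain ⟨hc''⟩ := hB.nonempty_isColimit_modelCofan (fun i : s => hG i) (fun i => 𝟙 _)
    (fun i => 𝟙 _) (fun i => Category.id_comp _) (fun i => id_quasiIso i)
  let e : c'.pt ≅ (quasiIso B).Q.obj (directSum fun i : s => G i) :=
    hc'.coconePointUniqueUpToIso hc''
  have hQb := isIso_Q_map _ hb
  have hba : (quasiIso B).Q.map (b ≫ τ) ≫ (quasiIso B).Q.map (σ ≫ a) = 𝟙 _ := by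
    have h : (b ≫ τ) ≫ σ ≫ a = b ≫ a := by
      rw [Category.assoc, ← Category.assoc τ, hτσ, Category.id_comp]
    rw [← Functor.map_comp, h, ← cancel_mono ((quasiIso B).Q.map b), ← Functor.map_comp,
      Category.assoc, hab]
    simp
  rw [hg, Category.assoc] at hba
  let F := homologyFunctor w n
  let r : F.obj ((quasiIso B).Q.obj M) ⟶ F.obj ((quasiIso B).Q.obj (directSum fun i : s => G i)) :=
    F.map (g ≫ e.hom)
  have hr : Mono r := by
    have : SplitMono r := ⟨F.map (e.inv ≫ Cofan.IsColimit.desc hc'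
      (fun i => Cofan.inj (modelCofan fun i => 𝟙 (G i)) i.1) ≫
      (quasiIso B).Q.map (σ ≫ a)), by
        rw [← F.map_comp, Category.assoc, e.hom_inv_id_assoc, hba]
        exact F.map_id _⟩
    exact this.mono
  let i := homologyIsoOfZero (isMinimal_directSum (fun i : s => hG i) w) n
  exact ⟨i.toLinearEquiv.toLinearMap ∘ₗ r.hom,
    i.toLinearEquiv.injective.comp ((ModuleCat.mono_iff_injective _).1 hr)⟩

end Compact

section Algebra

variable {B : Type u} [Ring B] [Algebra k B]

variable (k B) in
/-- The free dg module over an algebra with one generator, of degree `n`. -/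
abbrev free (n : ℤ) : DGMod (DGCat.ofAlgebra k B) where
  obj _ :=
    { X := fun p => ModuleCat.of k (algDegree k B (p - n))
      d := fun _ _ => 0 }
  act {w w' p q r} h := algMul k B (by omega)
  act_one _ := Subtype.ext (mul_one _)
  act_act _ _ _ _ _ _ _ := Subtype.ext (mul_assoc _ _ _)
  d_act {w w' p q r p' q' r'} h hp hq hr m b := by
    change (0 : algDegree k B (r' - n)) = algMul k B _ (0 : algDegree k B (p' - n)) b
      + p.negOnePow • algMul k B _ m (0 : algDegree k B q')
    rw [(algMul k B _).map_zero₂, map_zero, smul_zero, add_zero]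

/-- The morphism from the free dg module given by a cocycle. -/
def freeDesc (X : DGMod (DGCat.ofAlgebra k B)) {n : ℤ} (x : X.cx.X n) (hx : X.IsMinimal) :
    free k B n ⟶ X :=
  { app := fun w =>
      { f := fun p => ModuleCat.ofHom
          (X.act (w := PUnit.unit) (w' := w) (p := n) (q := p - n) (n := p) (by omega) x)
        comm' := fun p q _ => by
          rw [hx w p q, comp_zero]
          exact zero_comp.symm }
    app_act := fun {w w' p q r} h m b =>
      (X.act_act (w := PUnit.unit) (w' := w) (w'' := w') (by omega) (by omega) h (by omega) x m
        b).symm : DGMod.Hom (free k B n) X }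

theorem freeDesc_one (X : DGMod (DGCat.ofAlgebra k B)) {n : ℤ} (x : X.cx.X n)
    (hx : X.IsMinimal) :
    (DGMod.Hom.app (freeDesc X x hx) PUnit.unit).f n
      (⟨1, fun h => absurd (sub_self n) h⟩ : algDegree k B (n - n)) = x := by
  have key (q : ℤ) (hq : q = 0) (h : n + q = n) :
      X.act (w := PUnit.unit) (w' := PUnit.unit) h x
        (⟨1, fun h => absurd hq h⟩ : algDegree k B q) = x := by
    subst hq
    exact X.act_one x
  exact key _ (sub_self n) _

/-- The cohomology of a compact dg module over a semisimple algebra is finite-dimensional: a minimal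
model is a direct summand of a direct sum of shifts of the algebra, and compactness leaves only
finitely many of them. -/
theorem IsCompact.hasFiniteHomology [IsSemisimpleRing B] [FiniteDimensional k B]
    {M : DGMod (DGCat.ofAlgebra k B)} (hM : M.IsCompact) : HasFiniteHomology M.cx := by
  have hB := hasMinimalModels_ofAlgebra (k := k) (B := B)
  obtain ⟨X, a, b, hX, hab, -, hb⟩ := hB M
  let ι := Σ n : ℤ, X.cx.X n
  let G : ι → DGMod (DGCat.ofAlgebra k B) := fun i => free k B i.1
  have hG (i : ι) : (G i).IsMinimal := fun _ _ _ => rfl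
  let σ : directSum G ⟶ X := directSumDesc fun i : ι => freeDesc X i.2 hX
  have hσ (n : ℤ) (x : X.cx.X n) :
      ∃ y : (directSum G).cx.X n, (DGMod.Hom.app σ PUnit.unit).f n y = x := by
    refine ⟨(DGMod.Hom.app (directSumι (N := G) ⟨n, x⟩) PUnit.unit).f n
      (⟨1, fun h => absurd (sub_self n) h⟩ : algDegree k B (n - n)), ?_⟩
    refine Eq.trans ?_ (freeDesc_one X x hX)
    exact congrArg (fun φ : G ⟨n, x⟩ ⟶ X => (DGMod.Hom.app φ PUnit.unit).f n
      (⟨1, fun h => absurd (sub_self n) h⟩ : algDegree k B (n - n)))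
      (directSumι_desc (fun i : ι => freeDesc X i.2 hX) ⟨n, x⟩)
  have hσρ (n : ℤ) (r : Bᵐᵒᵖ) (y : (directSum G).cx.X n) :
      (DGMod.Hom.app σ PUnit.unit).f n ((directSum G).rightAct n r y) =
        X.rightAct n r ((DGMod.Hom.app σ PUnit.unit).f n y) :=
    σ.app_act (w' := PUnit.unit) (add_zero n) y (degreeZero B k r.unop)
  choose t ht hst using fun n => LinearMap.exists_equivariant_pseudoInverse
    ((directSum G).rightAct n) (X.rightAct n) ((DGMod.Hom.app σ PUnit.unit).f n).hom (hσρ n)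
  let τ : X ⟶ directSum G := homOfRightAct (M := X) (N := directSum G)
    { f := fun n => ModuleCat.ofHom (t n)
      comm' := fun n m _ => by
        rw [isMinimal_directSum hG _ n m, hX _ n m, comp_zero, zero_comp] } fun n r x => ht n r x
  have hτσ : τ ≫ σ = 𝟙 X := by
    apply DGMod.Hom.ext
    funext _
    refine HomologicalComplex.hom_ext _ _ fun n => ModuleCat.hom_ext (LinearMap.ext fun x => ?_)
    obtain ⟨y, rfl⟩ := hσ n x
    exact hst n y
  obtain ⟨s, hs⟩ := hB.exists_injective_of_isCompact hM a b hab hb hG τ σ hτσ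
  have hfin (i : ι) (n : ℤ) : Module.Finite k ((G i).cx.X n) :=
    inferInstanceAs (Module.Finite k (algDegree k B (n - i.1)))
  refine ⟨fun n => ?_, ?_⟩
  · obtain ⟨φ, hφ⟩ := hs PUnit.unit n
    have : Module.Finite k (Π₀ i : s, (G i).cx.X n) := inferInstance
    exact Module.Finite.of_injective φ hφ
  · refine (s.image Sigma.fst).finite_toSet.subset fun n hn => ?_
    by_contra hns
    apply hn
    obtain ⟨φ, hφ⟩ := hs PUnit.unit n
    have (i : s) : Subsingleton ((G i).cx.X n) := ⟨fun x y => by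
      have hi : n - i.1.1 ≠ 0 := fun h => hns (by
        rw [Finset.mem_coe, Finset.mem_image]
        exact ⟨i.1, i.2, by omega⟩)
      exact Subtype.ext (((x : algDegree k B (n - i.1.1)).2 hi).trans
        ((y : algDegree k B (n - i.1.1)).2 hi).symm)⟩
    have : Subsingleton (Π₀ i : s, (G i).cx.X n) := inferInstance
    have : Subsingleton (M.cx.homology n) := hφ.subsingleton
    exact Module.finrank_zero_of_subsingleton

end Algebra

end DGMod

/-! ### The Euler characteristic on the Grothendieck groups -/

theorem eulerChar_eq_add {K L M : CochainComplex (ModuleCat.{u} k) ℤ} (f : K ⟶ L) (g : L ⟶ M)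
    (h : ∀ n, Function.Injective (f.f n).hom ∧ Function.Exact (f.f n).hom (g.f n).hom ∧
      Function.Surjective (g.f n).hom)
    (hK : HasFiniteHomology K) (hL : HasFiniteHomology L) (hM : HasFiniteHomology M) :
    eulerChar L = eulerChar K + eulerChar M := by
  have zero : f ≫ g = 0 := by
    refine HomologicalComplex.hom_ext _ _ fun n => ModuleCat.hom_ext (LinearMap.ext fun v => ?_)
    exact (h n).2.1.apply_apply_eq_zero v
  exact eulerChar_of_shortExact (S := ShortComplex.mk f g zero)
    (HomologicalComplex.shortExact_of_degreewise_shortExact _ fun n =>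
      ModuleCat.shortComplex_shortExact _ (h n).2.1 (h n).1 (h n).2.2) hK hL hM

namespace DGBimod

variable {A B C : DGCat k}

/-- The complex `M(x, w)` as a functor of `M`. -/
abbrev evalFunctor (x : A.Obj) (w : B.Obj) : DGBimod A B ⥤ CochainComplex (ModuleCat.{u} k) ℤ where
  obj M := M.obj x w
  map f := DGMod.Hom.app (DGBimod.Hom.app f x) w
  map_id _ := rfl
  map_comp _ _ := rfl

/-- The cohomology of the complex `M(x, w)`, as a functor on the derived category. -/
noncomputable def homologyFunctor (x : A.Obj) (w : B.Obj) (n : ℤ) :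
    Derived A B ⥤ ModuleCat.{u} k :=
  Localization.Construction.lift
    (evalFunctor x w ⋙ HomologicalComplex.homologyFunctor (ModuleCat.{u} k) (ComplexShape.up ℤ) n)
    (fun M N f (hf : ∀ x w, QuasiIso (DGMod.Hom.app (DGBimod.Hom.app f x) w)) => by
      have := hf x w
      change IsIso (HomologicalComplex.homologyMap (DGMod.Hom.app (DGBimod.Hom.app f x) w) n)
      infer_instance)

theorem nonempty_homology_iso {M N : DGBimod A B} (h : Nonempty (M.toDerived ≅ N.toDerived))
    (x : A.Obj) (w : B.Obj) (n : ℤ) :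
    Nonempty ((M.obj x w).homology n ≅ (N.obj x w).homology n) :=
  h.map (homologyFunctor x w n).mapIso

theorem nonempty_homology_iso_of_quasiIso {M N : DGBimod A B} (f : M ⟶ N) (hf : quasiIso A B f)
    (x : A.Obj) (w : B.Obj) (n : ℤ) :
    Nonempty ((M.obj x w).homology n ≅ (N.obj x w).homology n) := by
  have := hf x w
  exact ⟨asIso (HomologicalComplex.homologyMap (DGMod.Hom.app (DGBimod.Hom.app f x) w) n)⟩

theorem IsShortExact.eulerChar_eq {X Y Z : DGBimod A B} {f : Hom X Y} {g : Hom Y Z}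
    (h : IsShortExact f g) (x : A.Obj) (w : B.Obj) (hX : HasFiniteHomology (X.obj x w))
    (hY : HasFiniteHomology (Y.obj x w)) (hZ : HasFiniteHomology (Z.obj x w)) :
    eulerChar (Y.obj x w) = eulerChar (X.obj x w) + eulerChar (Z.obj x w) := by
  exact eulerChar_eq_add ((f.app x).app w) ((g.app x).app w) (h x w) hX hY hZ

end DGBimod

namespace Hmo0

variable {X Y : Hmo0 k}

/-- The Euler characteristic of the cohomology of `M(x, y)`, as a homomorphism on `K₀ rep(X, Y)`. -/
noncomputable def eulerHom (x : X.dgCat.Obj) (y : Y.dgCat.Obj)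
    (hfin : ∀ M : DGBimod X.dgCat Y.dgCat, M.IsRep → HasFiniteHomology (M.obj x y)) :
    Hom X Y →+ ℤ :=
  QuotientAddGroup.lift (relations X.dgCat Y.dgCat)
    (FreeAbelianGroup.lift fun M : {M : DGBimod X.dgCat Y.dgCat // M.IsRep} =>
      eulerChar (M.1.obj x y)) <| by
    rw [relations, AddSubgroup.closure_le]
    rintro _ ⟨L, M, N, ⟨L', M', N', f, g, hfg, hL, hM, hN⟩, rfl⟩
    have iso {P Q : DGBimod X.dgCat Y.dgCat} (h : Nonempty (P.toDerived ≅ Q.toDerived)) :=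
      DGBimod.nonempty_homology_iso h x y
    change FreeAbelianGroup.lift _ _ = (0 : ℤ)
    rw [map_sub, map_sub, FreeAbelianGroup.lift_apply_of, FreeAbelianGroup.lift_apply_of,
      FreeAbelianGroup.lift_apply_of, eulerChar_congr (iso hL), eulerChar_congr (iso hM),
      eulerChar_congr (iso hN), hfg.eulerChar_eq x y ((hfin _ L.2).congr (iso hL))
        ((hfin _ M.2).congr (iso hM)) ((hfin _ N.2).congr (iso hN))]
    ring

theorem eulerHom_cls (x : X.dgCat.Obj) (y : Y.dgCat.Obj)
    (hfin : ∀ M : DGBimod X.dgCat Y.dgCat, M.IsRep → HasFiniteHomology (M.obj x y))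
    (M : DGBimod X.dgCat Y.dgCat) (hM : M.IsRep) :
    eulerHom x y hfin (cls M hM) = eulerChar (M.obj x y) :=
  FreeAbelianGroup.lift_apply_of _ _

theorem dvd_eulerHom (x : X.dgCat.Obj) (y : Y.dgCat.Obj)
    (hfin : ∀ M : DGBimod X.dgCat Y.dgCat, M.IsRep → HasFiniteHomology (M.obj x y)) {s : ℤ}
    (hs : ∀ M : DGBimod X.dgCat Y.dgCat, M.IsRep → s ∣ eulerChar (M.obj x y)) (α : Hom X Y) :
    s ∣ eulerHom x y hfin α := by
  obtain ⟨α, rfl⟩ := QuotientAddGroup.mk_surjective α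
  induction α using FreeAbelianGroup.induction_on with
  | zero => exact (map_zero (eulerHom x y hfin)).symm ▸ dvd_zero s
  | of M => exact (eulerHom_cls x y hfin M.1 M.2).symm ▸ hs M.1 M.2
  | neg M _ =>
    rw [QuotientAddGroup.mk_neg, map_neg, dvd_neg]
    exact (eulerHom_cls x y hfin M.1 M.2).symm ▸ hs M.1 M.2
  | add α β hα hβ =>
    rw [QuotientAddGroup.mk_add, map_add]
    exact dvd_add hα hβ

end Hmo0

/-! ### The Künneth formula -/

/-- The restriction of a representation to the range of an equivariant endomorphism. -/
def restrictRange {R V : Type*} [Ring R] [Algebra k R] [AddCommGroup V] [Module k V]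
    (ρ : R →ₐ[k] Module.End k V) (e : V →ₗ[k] V) (he : ∀ r v, e (ρ r v) = ρ r (e v)) :
    R →ₐ[k] Module.End k (LinearMap.range e) :=
  AlgHom.ofLinearMap
    { toFun := fun r => (ρ r).restrict (by rintro _ ⟨v, rfl⟩; exact ⟨ρ r v, he r v⟩)
      map_add' := fun r s => by ext v; simp
      map_smul' := fun c r => by ext v; simp }
    (by ext v; simp) (fun r s => by ext v; simp)

namespace DGBimod

section LeftAction

variable {B : Type u} [Ring B] [Algebra k B] {C : DGCat k} (N : DGBimod (DGCat.ofAlgebra k B) C)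

/-- The left action in degree `n` for a bimodule over an algebra concentrated in degree `0`. -/
def leftAct (z : C.Obj) (n : ℤ) : B →ₐ[k] Module.End k ((N.obj PUnit.unit z).X n) :=
  AlgHom.ofLinearMap
    { toFun := fun b => N.lact (x' := PUnit.unit) (zero_add n) (DGMod.degreeZero B k b)
      map_add' := fun a b => LinearMap.map_add (N.lact (x' := PUnit.unit) (zero_add n))
        (DGMod.degreeZero B k a) (DGMod.degreeZero B k b)
      map_smul' := fun c b => LinearMap.map_smul (N.lact (x' := PUnit.unit) (zero_add n)) c
        (DGMod.degreeZero B k b) }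
    (by ext m; exact N.one_lact m)
    (fun a b => by
      ext m
      exact N.lact_lact (x' := PUnit.unit) (x'' := PUnit.unit) (zero_add 0) (zero_add n)
        (zero_add n) (zero_add n) (DGMod.degreeZero B k a) (DGMod.degreeZero B k b) m)

theorem d_leftAct (z : C.Obj) (n m : ℤ) (b : B) (x : (N.obj PUnit.unit z).X n) :
    (N.obj PUnit.unit z).d n m (N.leftAct z n b x) =
      N.leftAct z m b ((N.obj PUnit.unit z).d n m x) := by
  by_cases h : n + 1 = m
  · have := N.d_lact (x' := PUnit.unit) (zero_add n) (zero_add 1) h h (DGMod.degreeZero B k b) x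
    refine this.trans ?_
    have h0 : (algComplex k B).d 0 1 (DGMod.degreeZero B k b) = 0 := rfl
    change N.lact (x' := PUnit.unit) _ ((algComplex k B).d 0 1 _) x + _ = _
    rw [h0, LinearMap.map_zero₂, zero_add, Int.negOnePow_zero, one_smul]
    rfl
  · rw [(N.obj PUnit.unit z).shape n m h]
    exact (map_zero (N.leftAct z m b)).symm

end LeftAction

section TensorProduct

variable {A B C : DGCat k} {M : DGBimod A B} {N : DGBimod B C} {T : DGBimod A C}

/-- Linear maps out of a tensor product agree if they agree on pure tensors. -/
theorem TensorProduct.hom_ext (t : TensorProduct M N T) {x : A.Obj} {z : C.Obj} {n : ℤ}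
    {W : Type u} [AddCommGroup W] [Module k W] {f g : (T.obj x z).X n →ₗ[k] W}
    (h : ∀ (b : B.Obj) (p q : ℤ) (h : p + q = n) (m : (M.obj x b).X p) (v : (N.obj b z).X q),
      f (t.μ h m v) = g (t.μ h m v)) : f = g := by
  obtain ⟨ψ, -, hψ⟩ := t.universal x z n W (fun b p q h => (t.μ h).compr₂ g)
    (fun b b' p q r s w hs ht hsn htn m β v => congrArg g (t.balanced hs ht hsn htn m β v))
  exact (hψ f h).trans (hψ g fun _ _ _ _ _ _ => rfl).symm

end TensorProduct

section Kunneth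

variable {A C : DGCat k} {B : Type u} [Ring B] [Algebra k B]
  {M : DGBimod A (DGCat.ofAlgebra k B)} {N : DGBimod (DGCat.ofAlgebra k B) C} {T : DGBimod A C}
  (t : TensorProduct M N T) (x : A.Obj) (z : C.Obj)

/-- Over an algebra, it is enough to check that a family of pairings is balanced for the elements of
degree `0`. -/
theorem TensorProduct.exists_lift (n : ℤ) (W : Type u) [AddCommGroup W] [Module k W]
    (φ : ∀ p q : ℤ, p + q = n →
      ((M.right x).cx.X p →ₗ[k] (N.obj PUnit.unit z).X q →ₗ[k] W))
    (hφ : ∀ p q h b m v, φ p q h ((M.right x).rightAct p (MulOpposite.op b) m) v =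
      φ p q h m (N.leftAct z q b v)) :
    ∃ ψ : (T.obj x z).X n →ₗ[k] W, ∀ p q h m v,
      ψ (t.μ (b := PUnit.unit) h m v) = φ p q h m v := by
  obtain ⟨ψ, hψ, -⟩ := t.universal x z n W (fun _ => φ)
    (fun b b' p q r s w hs ht hsn htn m β v => by
      by_cases hq : q = 0
      · subst hq
        obtain rfl : p = s := by omega
        obtain rfl : r = w := by omega
        exact hφ p r hsn (β : algDegree k B 0).1 m v
      · have hβ : β = 0 := Subtype.ext ((β : algDegree k B q).2 hq)
        rw [hβ, map_zero, LinearMap.map_zero₂, LinearMap.map_zero₂, map_zero])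
  exact ⟨ψ, hψ PUnit.unit⟩

variable (H : Harmonic (M.right x).cx) (H' : Harmonic (N.obj PUnit.unit z))
  (he : ∀ n b v, H.e n ((M.right x).rightAct n b v) = (M.right x).rightAct n b (H.e n v))
  (hh : ∀ p q b v, H.h p q ((M.right x).rightAct p b v) = (M.right x).rightAct q b (H.h p q v))
  (he' : ∀ n b v, H'.e n (N.leftAct z n b v) = N.leftAct z n b (H'.e n v))
  (hh' : ∀ p q b v, H'.h p q (N.leftAct z p b v) = N.leftAct z q b (H'.h p q v))

include he hh he' hh' in
/-- Harmonic decompositions of two complexes give one of their tensor product: the projection is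
`e ⊗ e'` and the homotopy is `h ⊗ 1 ± e ⊗ h'`. -/
theorem TensorProduct.exists_harmonic :
    ∃ E : Harmonic (T.obj x z), ∀ (p q n : ℤ) (h : p + q = n) (m) (v),
      E.e n (t.μ (b := PUnit.unit) h m v) = t.μ (b := PUnit.unit) h (H.e p m) (H'.e q v) := by
  have bal {p q n : ℤ} (h : p + q = n) (b : B) (m : (M.right x).cx.X p)
      (v : (N.obj PUnit.unit z).X q) :
      t.μ (b := PUnit.unit) h ((M.right x).rightAct p (MulOpposite.op b) m) v =
        t.μ (b := PUnit.unit) h m (N.leftAct z q b v) :=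
    t.balanced (b := PUnit.unit) (b' := PUnit.unit) (add_zero p) (zero_add q) h h m
      (DGMod.degreeZero B k b) v
  choose e hE using fun n => t.exists_lift x z n ((T.obj x z).X n)
    (fun p q h => (t.μ (b := PUnit.unit) h).compl₁₂ (H.e p) (H'.e q))
    (fun p q h b m v => by
      simp only [LinearMap.compl₁₂_apply]
      rw [he, he', bal])
  choose s hS using fun n n' (hn : n' + 1 = n) => t.exists_lift x z n ((T.obj x z).X n')
    (fun p q h => (t.μ (b := PUnit.unit) (p := p - 1) (q := q) (by omega)).compl₁₂ (H.h p (p - 1))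
        LinearMap.id + p.negOnePow • (t.μ (b := PUnit.unit) (p := p) (q := q - 1)
          (by omega)).compl₁₂ (H.e p) (H'.h q (q - 1)))
    (fun p q h b m v => by
      simp only [LinearMap.add_apply, LinearMap.smul_apply, LinearMap.compl₁₂_apply,
        LinearMap.id_apply]
      rw [hh, he, bal, bal, hh'])
  replace hE (n p q : ℤ) (h : p + q = n) (m) (v) : e n (t.μ (b := PUnit.unit) h m v) =
    t.μ (b := PUnit.unit) h (H.e p m) (H'.e q v) := hE n p q h m v
  replace hS (n n' p q p' q' : ℤ) (hn : n' + 1 = n) (h : p + q = n) (hp : p' + 1 = p)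
      (hq : q' + 1 = q) (m) (v) :
      s n n' hn (t.μ (b := PUnit.unit) h m v) =
        t.μ (b := PUnit.unit) (by omega) (H.h p p' m) v +
          p.negOnePow • t.μ (b := PUnit.unit) (by omega) (H.e p m) (H'.h q q' v) := by
    obtain rfl : p' = p - 1 := by omega
    obtain rfl : q' = q - 1 := by omega
    exact hS n n' hn p q h m v
  have dμ (n n' p q p' q' : ℤ) (hn : n + 1 = n') (h : p + q = n) (hp : p + 1 = p')
      (hq : q + 1 = q') (m) (v) :
      (T.obj x z).d n n' (t.μ (b := PUnit.unit) h m v) =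
        t.μ (b := PUnit.unit) (by omega) ((M.right x).cx.d p p' m) v +
          p.negOnePow • t.μ (b := PUnit.unit) (by omega) m ((N.obj PUnit.unit z).d q q' v) :=
    t.d_μ (b := PUnit.unit) h hp hq hn m v
  refine ⟨{ e := e, h := fun n n' => if hn : n' + 1 = n then s n n' hn else 0, d_e := ?_,
            e_d := ?_, e_e := ?_, homotopy := ?_ }, fun p q n h m v => hE n p q h m v⟩
  · intro n n' y
    by_cases hn : n + 1 = n'
    · refine LinearMap.congr_fun (f := ((T.obj x z).d n n').hom ∘ₗ e n) (g := 0)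
        (t.hom_ext ?_) y
      rintro ⟨⟩ p q h m v
      change (T.obj x z).d n n' (e n (t.μ (b := PUnit.unit) h m v)) = 0
      rw [hE, dμ n n' p q _ _ hn h rfl rfl, H.d_e, H'.d_e, LinearMap.map_zero₂,
        map_zero, smul_zero, add_zero]
    · rw [(T.obj x z).shape n n' hn]; rfl
  · intro n n' y
    by_cases hn : n + 1 = n'
    · refine LinearMap.congr_fun (f := e n' ∘ₗ ((T.obj x z).d n n').hom) (g := 0)
        (t.hom_ext ?_) y
      rintro ⟨⟩ p q h m v
      change e n' ((T.obj x z).d n n' (t.μ (b := PUnit.unit) h m v)) = 0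
      rw [dμ n n' p q _ _ hn h rfl rfl, map_add, LinearMap.map_smul_of_tower, hE, hE, H.e_d,
        H'.e_d, LinearMap.map_zero₂, map_zero, smul_zero, add_zero]
    · rw [(T.obj x z).shape n n' hn]; exact map_zero _
  · intro n y
    refine LinearMap.congr_fun (f := e n ∘ₗ e n) (g := e n) (t.hom_ext ?_) y
    rintro ⟨⟩ p q h m v
    change e n (e n (t.μ (b := PUnit.unit) h m v)) = e n (t.μ (b := PUnit.unit) h m v)
    rw [hE, hE, H.e_e, H'.e_e]
  · intro n' n n'' hn' hn'' y
    rw [dif_pos hn', dif_pos hn'']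
    refine LinearMap.congr_fun (f := LinearMap.id) (g := e n' + (((T.obj x z).d n n').hom ∘ₗ
      s n' n hn' + s n'' n' hn'' ∘ₗ ((T.obj x z).d n' n'').hom)) (t.hom_ext ?_) y
    rintro ⟨⟩ p q h m v
    change t.μ (b := PUnit.unit) h m v = e n' (t.μ (b := PUnit.unit) h m v) +
      ((T.obj x z).d n n' (s n' n hn' (t.μ (b := PUnit.unit) h m v)) +
        s n'' n' hn'' ((T.obj x z).d n' n'' (t.μ (b := PUnit.unit) h m v)))
    have hp : p - 1 + 1 = p := by omega
    have hq : q - 1 + 1 = q := by omega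
    have hm := H.homotopy hp rfl m
    have hv := H'.homotopy hq rfl v
    rw [hE, hS n' n p q (p - 1) (q - 1) hn' h hp hq, map_add, LinearMap.map_smul_of_tower,
      dμ n n' (p - 1) q p (q + 1) hn' _ hp rfl, dμ n n' p (q - 1) (p + 1) q hn' _ rfl hq, H.d_e,
      LinearMap.map_zero₂, zero_add, dμ n' n'' p q (p + 1) (q + 1) hn'' h rfl rfl, map_add,
      LinearMap.map_smul_of_tower, hS n'' n' (p + 1) q p (q - 1) hn'' _ rfl hq,
      hS n'' n' p (q + 1) (p - 1) q hn'' _ hp rfl, H.e_d, LinearMap.map_zero₂, smul_zero, add_zero]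
    -- The mixed terms `h m ⊗ d v` cancel, and what remains is
    -- `m ⊗ v = e m ⊗ v + (d h + h d) m ⊗ v` and `e m ⊗ v = e m ⊗ e' v + e m ⊗ (d h' + h' d) v`.
    have h₁ := congrArg (fun m => t.μ (b := PUnit.unit) h m v) hm
    have h₂ := congrArg (t.μ (b := PUnit.unit) h (H.e p m)) hv
    simp only [map_add, LinearMap.add_apply] at h₁ h₂
    have hp₁ : (p - 1).negOnePow = -p.negOnePow := by rw [Int.negOnePow_sub]; simp
    rw [h₁, h₂, hp₁]
    simp only [smul_add, smul_smul, Int.units_mul_self, one_smul, Units.neg_smul]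
    abel

variable {H H'} in
/-- The Künneth formula in one degree: a linear form on the harmonic elements of `M ⊗ N` is a
family of balanced pairings of the harmonic elements of `M` and of `N`. -/
theorem TensorProduct.finrank_range_mul [IsSimpleRing B] [FiniteDimensional k B]
    (he : ∀ n b v, H.e n ((M.right x).rightAct n b v) = (M.right x).rightAct n b (H.e n v))
    (he' : ∀ n b v, H'.e n (N.leftAct z n b v) = N.leftAct z n b (H'.e n v))
    {E : Harmonic (T.obj x z)} (hE : ∀ (p q n : ℤ) (h : p + q = n) (m) (v),
      E.e n (t.μ (b := PUnit.unit) h m v) = t.μ (b := PUnit.unit) h (H.e p m) (H'.e q v))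
    [∀ p, Module.Finite k (LinearMap.range (H.e p))]
    [∀ q, Module.Finite k (LinearMap.range (H'.e q))]
    (F G : Finset ℤ) (hF : ∀ p ∉ F, H.e p = 0) (hG : ∀ q ∉ G, H'.e q = 0) (n : ℤ) :
    Module.finrank k (LinearMap.range (E.e n)) * Module.finrank k B =
      ∑ i ∈ F ×ˢ G with i.1 + i.2 = n,
        Module.finrank k (LinearMap.range (H.e i.1)) *
          Module.finrank k (LinearMap.range (H'.e i.2)) := by
  let S : Finset (ℤ × ℤ) := (F ×ˢ G).filter fun i => i.1 + i.2 = n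
  let I := {i // i ∈ S}
  have hI (i : I) : i.1.1 + i.1.2 = n := (Finset.mem_filter.1 i.2).2
  have bal {p q n : ℤ} (h : p + q = n) (b : B) (m : (M.right x).cx.X p)
      (v : (N.obj PUnit.unit z).X q) :
      t.μ (b := PUnit.unit) h ((M.right x).rightAct p (MulOpposite.op b) m) v =
        t.μ (b := PUnit.unit) h m (N.leftAct z q b v) :=
    t.balanced (b := PUnit.unit) (b' := PUnit.unit) (add_zero p) (zero_add q) h h m
      (DGMod.degreeZero B k b) v
  let P (i : I) := balancedPairing (restrictRange ((M.right x).rightAct i.1.1) _ (he i.1.1))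
    (restrictRange (N.leftAct z i.1.2) _ (he' i.1.2))
  let μ (i : I) : LinearMap.range (H.e i.1.1) →ₗ[k] LinearMap.range (H'.e i.1.2) →ₗ[k]
      LinearMap.range (E.e n) :=
    ((t.μ (b := PUnit.unit) (hI i)).compl₁₂ (Submodule.subtype _) (Submodule.subtype _)).compr₂
      (E.e n).rangeRestrict
  let Φ : Module.Dual k (LinearMap.range (E.e n)) →ₗ[k] ∀ i, P i :=
    LinearMap.pi fun i => LinearMap.codRestrict (P i)
      { toFun := fun f => (μ i).compr₂ f
        map_add' := fun f g => rfl
        map_smul' := fun c f => rfl } (fun f b v w => by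
          refine congrArg f (congrArg (E.e n).rangeRestrict ?_)
          exact bal (hI i) b v w)
  -- A form on the range of `E` is determined by its values on the tensors `e m ⊗ e' v`.
  have inj : Function.Injective Φ := by
    rw [injective_iff_map_eq_zero]
    intro f hf
    have key : f ∘ₗ (E.e n).rangeRestrict = 0 := t.hom_ext (by
      rintro ⟨⟩ p q h m v
      have e₁ : (E.e n).rangeRestrict (t.μ (b := PUnit.unit) h m v) =
          (E.e n).rangeRestrict (t.μ (b := PUnit.unit) h (H.e p m) (H'.e q v)) := by
        apply Subtype.ext
        change E.e n _ = E.e n _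
        rw [hE, hE, H.e_e, H'.e_e]
      change f ((E.e n).rangeRestrict _) = 0
      rw [e₁]
      by_cases hp : p ∈ F
      · by_cases hq : q ∈ G
        · have hi : (p, q) ∈ S :=
            Finset.mem_filter.2 ⟨Finset.mk_mem_product hp hq, h⟩
          have := congrArg Subtype.val (congrFun hf ⟨(p, q), hi⟩)
          exact LinearMap.congr_fun₂ this ⟨H.e p m, m, rfl⟩ ⟨H'.e q v, v, rfl⟩
        · rw [hG q hq, LinearMap.zero_apply, map_zero, map_zero, map_zero]
      · rw [hF p hp, LinearMap.zero_apply, LinearMap.map_zero₂, map_zero, map_zero])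
    ext ⟨_, y, rfl⟩
    exact LinearMap.congr_fun key y
  -- A family of pairings `β` is extended to `M × N` by means of the projections `e` and `e'`.
  have surj : Function.Surjective Φ := by
    intro β
    obtain ⟨ψ, hψ⟩ := t.exists_lift x z n k (fun p q h =>
      if hi : (p, q) ∈ S then
        (β ⟨(p, q), hi⟩).1.compl₁₂ (H.e p).rangeRestrict (H'.e q).rangeRestrict
      else 0) (fun p q h b m v => by
        split_ifs with hi
        · have := (β ⟨(p, q), hi⟩).2 b ((H.e p).rangeRestrict m) ((H'.e q).rangeRestrict v)
          refine (congrArg (fun m' => (β ⟨(p, q), hi⟩).1 m' _) ?_).trans (this.trans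
            (congrArg ((β ⟨(p, q), hi⟩).1 _) ?_))
          · exact Subtype.ext (he p _ m)
          · exact Subtype.ext (he' q _ v).symm
        · rfl)
    refine ⟨ψ ∘ₗ Submodule.subtype _, funext fun i => Subtype.ext ?_⟩
    ext v w
    have e₁ := hψ i.1.1 i.1.2 (hI i) v.1 w.1
    rw [dif_pos i.2] at e₁
    change ψ (E.e n (t.μ (b := PUnit.unit) (hI i) v.1 w.1)) = _
    rw [hE, H.e_coe, H'.e_coe, e₁]
    refine congrArg₂ (fun v w => (β i).1 v w) (Subtype.ext (H.e_coe v)) (Subtype.ext (H'.e_coe w))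
  have (i : I) : Module.Finite k (P i) := inferInstance
  -- The additive group structure is derived from the module structure, because the one of `P i`
  -- as a submodule is not found by instance search.
  have (i : I) : Module.Free k (P i) :=
    @Module.Free.of_divisionRing k (P i) _ (Module.addCommMonoidToAddCommGroup k) _
  rw [← Subspace.dual_finrank_eq, (LinearEquiv.ofBijective Φ ⟨inj, surj⟩).finrank_eq,
    Module.finrank_pi_fintype, Finset.sum_mul]
  exact (Finset.sum_congr rfl fun i _ => finrank_balancedPairing_mul _ _).trans
    (Finset.sum_coe_sort S fun i => Module.finrank k (LinearMap.range (H.e i.1)) *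
      Module.finrank k (LinearMap.range (H'.e i.2)))

include t in
/-- The Künneth formula over a simple algebra: `χ(M ⊗_B N) · dim B = χ(M) χ(N)`. -/
theorem TensorProduct.eulerChar_mul [IsSimpleRing B] [FiniteDimensional k B]
    (hM : HasFiniteHomology (M.right x).cx) (hN : HasFiniteHomology (N.obj PUnit.unit z)) :
    eulerChar (T.obj x z) * Module.finrank k B =
      eulerChar (M.right x).cx * eulerChar (N.obj PUnit.unit z) := by
  have : IsArtinianRing B := IsArtinianRing.of_finite k B
  obtain ⟨H, he, hh⟩ := exists_equivariant_harmonic (M.right x).cx (M.right x).rightAct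
    (M.right x).d_rightAct
  obtain ⟨H', he', hh'⟩ := exists_equivariant_harmonic (N.obj PUnit.unit z) (N.leftAct z)
    (N.d_leftAct z)
  obtain ⟨E, hE⟩ := t.exists_harmonic x z H H' he hh he' hh'
  have fin {K : CochainComplex (ModuleCat.{u} k) ℤ} (H : Harmonic K) (hK : HasFiniteHomology K)
      (n : ℤ) : Module.Finite k (LinearMap.range (H.e n)) :=
    have := hK.1 n
    Module.Finite.equiv (H.homologyEquiv n)
  have := fin H hM
  have := fin H' hN
  have zero {K : CochainComplex (ModuleCat.{u} k) ℤ} (H : Harmonic K) (hK : HasFiniteHomology K)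
      (n : ℤ) (hn : n ∉ hK.2.toFinset) : Module.finrank k (LinearMap.range (H.e n)) = 0 := by
    rwa [Set.Finite.mem_toFinset, Set.mem_ofPred_eq, not_not,
      (H.homologyEquiv n).finrank_eq] at hn
  have key := t.finrank_range_mul x z he he' hE hM.2.toFinset hN.2.toFinset
    (fun p hp => LinearMap.range_eq_bot.1 (Submodule.finrank_eq_zero.1 (zero H hM p hp)))
    (fun q hq => LinearMap.range_eq_bot.1 (Submodule.finrank_eq_zero.1 (zero H' hN q hq)))
  set F := hM.2.toFinset
  set G := hN.2.toFinset
  have sum {K : CochainComplex (ModuleCat.{u} k) ℤ} (H : Harmonic K) (F : Finset ℤ)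
      (hF : ∀ n ∉ F, Module.finrank k (LinearMap.range (H.e n)) = 0) : eulerChar K =
      ∑ n ∈ F, (n.negOnePow : ℤ) * Module.finrank k (LinearMap.range (H.e n)) := by
    refine (finsum_congr fun n => ?_).trans (finsum_eq_sum_of_support_subset _ fun n hn => ?_)
    · rw [(H.homologyEquiv n).finrank_eq]
    · by_contra h
      exact hn (by simp [hF n h])
  have hB : Module.finrank k B ≠ 0 := Module.finrank_pos.ne'
  let D := (F ×ˢ G).image fun i => i.1 + i.2
  rw [sum E D fun n hn => ?_, sum H F (zero H hM), sum H' G (zero H' hN), Finset.sum_mul_sum,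
    ← Finset.sum_product', Finset.sum_mul, ← Finset.sum_fiberwise_of_maps_to
      (fun i hi => Finset.mem_image_of_mem (fun i : ℤ × ℤ => i.1 + i.2) hi)]
  · refine Finset.sum_congr rfl fun n _ => ?_
    have := congrArg (Nat.cast : ℕ → ℤ) (key n)
    push_cast at this
    rw [mul_assoc, this, Finset.mul_sum]
    refine Finset.sum_congr rfl fun i hi => ?_
    rw [← (Finset.mem_filter.1 hi).2, Int.negOnePow_add]
    push_cast
    ring
  · have := key n
    rw [Finset.filter_eq_empty_iff.2 fun i hi h => hn (Finset.mem_image.2 ⟨i, hi, h⟩),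
      Finset.sum_empty] at this
    exact (Nat.mul_eq_zero.1 this).resolve_right hB

end Kunneth

end DGBimod

/-! ### Isomorphic motives have equal Brauer classes -/

/-- The Euler characteristic of a complex of `R`-modules is divisible by every number that divides
the dimensions of all finite-dimensional `R`-modules. -/
theorem dvd_eulerChar {R : Type u} [Ring R] [Algebra k R] [IsSemisimpleRing R]
    {K : CochainComplex (ModuleCat.{u} k) ℤ} (hK : HasFiniteHomology K)
    (ρ : ∀ n, R →ₐ[k] Module.End k (K.X n))
    (hρ : ∀ n m r x, K.d n m (ρ n r x) = ρ m r (K.d n m x)) (s : ℕ)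
    (hs : ∀ (V : Type u) [AddCommGroup V] [Module k V] [Module.Finite k V],
      (R →ₐ[k] Module.End k V) → s ∣ Module.finrank k V) : (s : ℤ) ∣ eulerChar K := by
  obtain ⟨H, he, -⟩ := exists_equivariant_harmonic K ρ hρ
  refine finsum_induction (fun a : ℤ => (s : ℤ) ∣ a) (dvd_zero _) (fun _ _ => dvd_add) fun n => ?_
  have := hK.1 n
  have : Module.Finite k (LinearMap.range (H.e n)) := Module.Finite.equiv (H.homologyEquiv n)
  rw [(H.homologyEquiv n).finrank_eq]
  exact (Int.natCast_dvd_natCast.2 (hs _ (restrictRange (ρ n) (H.e n) (he n)))).mul_left _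

theorem eulerChar_algComplex (A : Type u) [Ring A] [Algebra k A] :
    eulerChar (algComplex k A) = Module.finrank k A := by
  have h (n : ℤ) : Module.finrank k ((algComplex k A).homology n) =
      Module.finrank k (algDegree k A n) :=
    (homologyIsoOfZero (K := algComplex k A) (fun _ _ => rfl) n).toLinearEquiv.finrank_eq
  have h0 : algDegree k A 0 = ⊤ := eq_top_iff.2 fun a _ hn => absurd rfl hn
  refine (finsum_eq_single _ 0 fun n hn => ?_).trans ?_
  · have : algDegree k A n = ⊥ := eq_bot_iff.2 fun a ha => ha hn
    rw [h, this, finrank_bot, Nat.cast_zero, mul_zero]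
  · rw [h, h0, finrank_top, Int.negOnePow_zero, Units.val_one, one_mul]

namespace DGBimod

theorem IsDerivedTensor.eulerChar_mul {A C : DGCat k} {B : Type u} [Ring B] [Algebra k B]
    [IsSimpleRing B] [FiniteDimensional k B] {M : DGBimod A (DGCat.ofAlgebra k B)}
    {N : DGBimod (DGCat.ofAlgebra k B) C} {P : DGBimod A C} (h : IsDerivedTensor M N P)
    (x : A.Obj) (z : C.Obj) (hM : HasFiniteHomology (M.obj x PUnit.unit))
    (hN : HasFiniteHomology (N.obj PUnit.unit z)) :
    eulerChar (M.obj x PUnit.unit) * eulerChar (N.obj PUnit.unit z) =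
      eulerChar (P.obj x z) * Module.finrank k B := by
  obtain ⟨M', f, T, hf, -, ⟨t⟩, hT⟩ := h
  have iso n := (nonempty_homology_iso_of_quasiIso f hf x PUnit.unit n).map Iso.symm
  rw [← eulerChar_congr (nonempty_homology_iso hT x z), eulerChar_congr iso]
  exact (t.eulerChar_mul x z (hM.congr iso) hN).symm

open scoped _root_.TensorProduct

variable {A B : Type u} [Ring A] [Algebra k A] [Ring B] [Algebra k B]
  (M : DGBimod (DGCat.ofAlgebra k A) (DGCat.ofAlgebra k B))

/-- A bimodule over algebras concentrated in degree `0`, as a complex of `A ⊗ Bᵐᵒᵖ`-modules. -/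
noncomputable def bimodAct (n : ℤ) :
    A ⊗[k] Bᵐᵒᵖ →ₐ[k] Module.End k ((M.obj PUnit.unit PUnit.unit).X n) :=
  Algebra.TensorProduct.lift (M.leftAct PUnit.unit n) ((M.right PUnit.unit).rightAct n)
    fun a b => show _ * _ = _ * _ from LinearMap.ext fun m =>
      (M.lact_act (x := PUnit.unit) (x' := PUnit.unit) (w := PUnit.unit) (w' := PUnit.unit)
        (zero_add n) (add_zero n) (add_zero n) (zero_add n) (DGMod.degreeZero A k a) m
        (DGMod.degreeZero B k b.unop)).symm

theorem bimodAct_tmul (n : ℤ) (a : A) (b : Bᵐᵒᵖ) (x : (M.obj PUnit.unit PUnit.unit).X n) :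
    M.bimodAct n (a ⊗ₜ b) x =
      M.leftAct PUnit.unit n a ((M.right PUnit.unit).rightAct n b x) :=
  LinearMap.congr_fun (Algebra.TensorProduct.lift_tmul _ _ _ a b) x

theorem d_bimodAct (n m : ℤ) (r : A ⊗[k] Bᵐᵒᵖ) (x : (M.obj PUnit.unit PUnit.unit).X n) :
    (M.obj PUnit.unit PUnit.unit).d n m (M.bimodAct n r x) =
      M.bimodAct m r ((M.obj PUnit.unit PUnit.unit).d n m x) := by
  induction r with
  | zero => rw [map_zero, map_zero]; exact map_zero _
  | add r s hr hs => rw [map_add, map_add, LinearMap.add_apply, map_add, hr, hs]; rfl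
  | tmul a b =>
    rw [bimodAct_tmul, bimodAct_tmul]
    exact (M.d_leftAct PUnit.unit n m a _).trans
      (congrArg (M.leftAct PUnit.unit m a) ((M.right PUnit.unit).d_rightAct n m b x))

end DGBimod

/-- The Euler characteristic is multiplicative for compositions, up to a constant `c`, if it is so
for derived tensor products. -/
theorem Hmo0.IsComp.eulerHom_mul {X Y Z : Hmo0 k} (x : X.dgCat.Obj) (y : Y.dgCat.Obj)
    (z : Z.dgCat.Obj)
    (hXY : ∀ M : DGBimod X.dgCat Y.dgCat, M.IsRep → HasFiniteHomology (M.obj x y))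
    (hYZ : ∀ M : DGBimod Y.dgCat Z.dgCat, M.IsRep → HasFiniteHomology (M.obj y z))
    (hXZ : ∀ M : DGBimod X.dgCat Z.dgCat, M.IsRep → HasFiniteHomology (M.obj x z)) (c : ℤ)
    (h : ∀ (M : DGBimod X.dgCat Y.dgCat) (N : DGBimod Y.dgCat Z.dgCat)
      (P : DGBimod X.dgCat Z.dgCat), M.IsRep → N.IsRep → DGBimod.IsDerivedTensor M N P →
      eulerChar (M.obj x y) * eulerChar (N.obj y z) = eulerChar (P.obj x z) * c)
    {α : Hom X Y} {β : Hom Y Z} {γ : Hom X Z} (hc : IsComp α β γ) :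
    eulerHom x y hXY α * eulerHom y z hYZ β = eulerHom x z hXZ γ * c := by
  induction hc with
  | tensor M N P hM hN hP ht =>
    rw [eulerHom_cls, eulerHom_cls, eulerHom_cls]
    exact h M N P hM hN ht
  | zero_left β => rw [map_zero, map_zero, zero_mul, zero_mul]
  | zero_right α => rw [map_zero, map_zero, mul_zero, zero_mul]
  | sub_left α α' β γ γ' _ _ h₁ h₂ => rw [map_sub, map_sub, sub_mul, sub_mul, h₁, h₂]
  | sub_right α β β' γ γ' _ _ h₁ h₂ => rw [map_sub, map_sub, mul_sub, sub_mul, h₁, h₂]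

/-- If all Euler characteristics of bimodules are divisible by `s`, and multiplicative up to the
constant `c`, then `s²` divides `c` times the Euler characteristic of the identity. -/
theorem Hmo0.sq_dvd_of_isomorphic {X Y : Hmo0 k} (x : X.dgCat.Obj) (y : Y.dgCat.Obj)
    (hXX : ∀ M : DGBimod X.dgCat X.dgCat, M.IsRep → HasFiniteHomology (M.obj x x))
    (hXY : ∀ M : DGBimod X.dgCat Y.dgCat, M.IsRep → HasFiniteHomology (M.obj x y))
    (hYX : ∀ M : DGBimod Y.dgCat X.dgCat, M.IsRep → HasFiniteHomology (M.obj y x)) {s c : ℤ}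
    (h : ∀ (M : DGBimod X.dgCat Y.dgCat) (N : DGBimod Y.dgCat X.dgCat)
      (P : DGBimod X.dgCat X.dgCat), M.IsRep → N.IsRep → DGBimod.IsDerivedTensor M N P →
      eulerChar (M.obj x y) * eulerChar (N.obj y x) = eulerChar (P.obj x x) * c)
    (hs : ∀ M : DGBimod X.dgCat Y.dgCat, M.IsRep → s ∣ eulerChar (M.obj x y))
    (hs' : ∀ M : DGBimod Y.dgCat X.dgCat, M.IsRep → s ∣ eulerChar (M.obj y x))
    (hiso : Isomorphic X Y) : s * s ∣ eulerChar (X.dgCat.Hom x x) * c := by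
  obtain ⟨α, β, -, -, ⟨hd, rfl⟩, -, hc, -⟩ := hiso
  have key := hc.eulerHom_mul x y x hXY hYX hXX c h
  rw [eulerHom_cls] at key
  exact (mul_dvd_mul (dvd_eulerHom x y hXY hs α) (dvd_eulerHom y x hYX hs' β)).trans key.dvd

open scoped TensorProduct in
theorem isBrauerEquivalent_of_isomorphic (A B : CSA.{u, u} k)
    (h : Hmo0.Isomorphic (U (DGCat.ofAlgebra k A)) (U (DGCat.ofAlgebra k B))) :
    IsBrauerEquivalent A B := by
  have : IsArtinianRing A := IsArtinianRing.of_finite k A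
  have : IsArtinianRing B := IsArtinianRing.of_finite k B
  let R := A ⊗[k] (B : Type u)ᵐᵒᵖ
  have : IsSimpleRing R := IsSimpleRing.tensorProduct _ _
  have : IsArtinianRing R := IsArtinianRing.of_finite k R
  have : IsSimpleRing ((B : Type u) ⊗[k] (A : Type u)ᵐᵒᵖ) := IsSimpleRing.tensorProduct _ _
  have : IsArtinianRing ((B : Type u) ⊗[k] (A : Type u)ᵐᵒᵖ) := IsArtinianRing.of_finite k _
  obtain ⟨S, hS, hSfin⟩ := exists_isSimpleModule (k := k) R
  have fin (A B : CSA.{u, u} k) [IsArtinianRing B]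
      (M : DGBimod (DGCat.ofAlgebra k A) (DGCat.ofAlgebra k B))
      (hM : M.IsRep) : HasFiniteHomology (M.obj PUnit.unit PUnit.unit) :=
    (hM PUnit.unit).hasFiniteHomology
  have hmul (M : DGBimod (DGCat.ofAlgebra k A) (DGCat.ofAlgebra k B))
      (N : DGBimod (DGCat.ofAlgebra k B) (DGCat.ofAlgebra k A))
      (P : DGBimod (DGCat.ofAlgebra k A) (DGCat.ofAlgebra k A)) (hM : M.IsRep) (hN : N.IsRep)
      (h : DGBimod.IsDerivedTensor M N P) :=
    h.eulerChar_mul PUnit.unit PUnit.unit (fin A B M hM) (fin B A N hN)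
  have hα (M : DGBimod (DGCat.ofAlgebra k A) (DGCat.ofAlgebra k B)) (hM : M.IsRep) :=
    dvd_eulerChar (fin A B M hM) M.bimodAct M.d_bimodAct (Module.finrank k S)
      fun V _ _ _ ρ => finrank_dvd_of_isSimpleModule (S := S) ρ
  have hβ (M : DGBimod (DGCat.ofAlgebra k B) (DGCat.ofAlgebra k A)) (hM : M.IsRep) :=
    dvd_eulerChar (fin B A M hM) M.bimodAct M.d_bimodAct (Module.finrank k S)
      fun V _ _ _ ρ => finrank_dvd_of_isSimpleModule_of_swap (S := S) ρ
  have key : (_ : ℤ) ∣ eulerChar (algComplex k A) * _ :=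
    Hmo0.sq_dvd_of_isomorphic (X := U (DGCat.ofAlgebra k A)) (Y := U (DGCat.ofAlgebra k B))
      PUnit.unit PUnit.unit (fin A A) (fin A B) (fin B A) hmul hα hβ h
  refine isBrauerEquivalent_of_sq_dvd A B S ?_
  rw [eulerChar_algComplex] at key
  rw [Module.finrank_tensorProduct, ← (MulOpposite.opLinearEquiv k (M := B)).finrank_eq]
  exact_mod_cast key

/-! ### Brauer equivalent algebras have isomorphic motives -/

/-- A (non-unital) embedding `ι` of the algebra `A` in the algebra `R` as a corner `e R e`, where
`e = ι 1` is a full idempotent, that is, `e` generates `R` as a two-sided ideal. The map `π` is the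
retraction `r ↦ ι⁻¹ (e r e)`. -/
structure FullCorner (k A R : Type u) [Field k] [Ring A] [Algebra k A] [Ring R] [Algebra k R] where
  ι : A →ₗ[k] R
  π : R →ₗ[k] A
  ι_mul (a b : A) : ι (a * b) = ι a * ι b
  π_ι (a : A) : π (ι a) = a
  ι_π (r : R) : ι (π r) = ι 1 * r * ι 1
  full : ∃ (n : ℕ) (u v : Fin n → R), ∑ i, u i * ι 1 * v i = 1

namespace FullCorner

variable {A B R : Type u} [Ring A] [Algebra k A] [Ring B] [Algebra k B] [Ring R] [Algebra k R]

/-- An algebra is a full corner of its matrix algebras. -/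
def matrix (A : Type u) [Ring A] [Algebra k A] (n : ℕ) [NeZero n] :
    FullCorner k A (Matrix (Fin n) (Fin n) A) where
  ι := Matrix.singleLinearMap k 0 0
  π := Matrix.entryLinearMap k A 0 0
  ι_mul a b := by simp
  π_ι a := by simp
  ι_π r := by
    ext i j
    simp [Matrix.single_mul_mul_single]
  full := ⟨n, fun i => Matrix.single i 0 1, fun i => Matrix.single 0 i 1, by
    simp [Matrix.sum_single_one]⟩

/-- A full corner of `R` is a full corner of any algebra isomorphic to `R`. -/
def trans {S : Type u} [Ring S] [Algebra k S] (c : FullCorner k A R) (e : R ≃ₐ[k] S) :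
    FullCorner k A S where
  ι := e.toLinearMap ∘ₗ c.ι
  π := c.π ∘ₗ e.symm.toLinearMap
  ι_mul a b := by simp [c.ι_mul]
  π_ι a := by simp [c.π_ι]
  ι_π r := by simp [c.ι_π]
  full := by
    obtain ⟨n, u, v, h⟩ := c.full
    refine ⟨n, fun i => e (u i), fun i => e (v i), ?_⟩
    simpa using congrArg e h

variable (c : FullCorner k A R) (d : FullCorner k B R)

theorem one_mul_ι (a : A) : c.ι 1 * c.ι a = c.ι a := by rw [← c.ι_mul, one_mul]

theorem ι_mul_one (a : A) : c.ι a * c.ι 1 = c.ι a := by rw [← c.ι_mul, mul_one]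

theorem π_ι_mul (a : A) (r : R) : c.π (c.ι a * r) = a * c.π r := by
  rw [← c.π_ι (a * c.π r), c.ι_mul, c.ι_π, ← c.π_ι (c.π (c.ι a * r)), c.ι_π]
  simp only [← mul_assoc, c.ι_mul_one, c.one_mul_ι]

theorem π_mul_ι (a : A) (r : R) : c.π (r * c.ι a) = c.π r * a := by
  rw [← c.π_ι (c.π r * a), c.ι_mul, c.ι_π, ← c.π_ι (c.π (r * c.ι a)), c.ι_π]
  simp only [mul_assoc, c.ι_mul_one, c.one_mul_ι]

/-- The part of degree `n` of the Peirce component `e R f`, viewed as a graded space concentrated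
in degree `0`, for the idempotents `e = c.ι 1` and `f = d.ι 1`. -/
def peirce (n : ℤ) : Submodule k R where
  carrier := {v | c.ι 1 * v = v ∧ v * d.ι 1 = v ∧ (n ≠ 0 → v = 0)}
  add_mem' hv hw := ⟨by rw [mul_add, hv.1, hw.1], by rw [add_mul, hv.2.1, hw.2.1],
    fun hn => by rw [hv.2.2 hn, hw.2.2 hn, add_zero]⟩
  zero_mem' := ⟨mul_zero _, zero_mul _, fun _ => rfl⟩
  smul_mem' a v hv := ⟨by rw [mul_smul_comm, hv.1], by rw [smul_mul_assoc, hv.2.1],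
    fun hn => by rw [hv.2.2 hn, smul_zero]⟩

variable {c d}

theorem ι_mul_mem {p q n : ℤ} (h : p + q = n) {a : A} (ha : a ∈ algDegree k A p) {v : R}
    (hv : v ∈ c.peirce d q) : c.ι a * v ∈ c.peirce d n :=
  ⟨by rw [← mul_assoc, c.one_mul_ι], by rw [mul_assoc, hv.2.1], fun hn => by
    by_cases hp : p = 0
    · rw [hv.2.2 (by omega), mul_zero]
    · rw [ha hp, map_zero, zero_mul]⟩

theorem mul_ι_mem {p q n : ℤ} (h : p + q = n) {v : R} (hv : v ∈ c.peirce d p) {b : B}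
    (hb : b ∈ algDegree k B q) : v * d.ι b ∈ c.peirce d n :=
  ⟨by rw [← mul_assoc, hv.1], by rw [mul_assoc, d.ι_mul_one], fun hn => by
    by_cases hq : q = 0
    · rw [hv.2.2 (by omega), zero_mul]
    · rw [hb hq, map_zero, mul_zero]⟩

theorem π_mul_mem {p q n : ℤ} (h : p + q = n) {v w : R} (hv : v ∈ c.peirce d p)
    (hw : w ∈ d.peirce c q) : c.π (v * w) ∈ algDegree k A n := fun hn => by
  by_cases hq : q = 0
  · rw [hv.2.2 (by omega), zero_mul, map_zero]
  · rw [hw.2.2 hq, mul_zero, map_zero]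

theorem ι_π_mul {p q : ℤ} {v w : R} (hv : v ∈ c.peirce d p) (hw : w ∈ d.peirce c q) :
    c.ι (c.π (v * w)) = v * w := by
  rw [c.ι_π, mul_assoc, mul_assoc, hw.2.1, ← mul_assoc, hv.1]

variable (c d)

/-- Since `f` is full, the idempotent `e` is in the image of `e R f ⊗ f R e`. -/
theorem exists_sum_mul_eq :
    ∃ (n : ℕ) (x : Fin n → c.peirce d 0) (y : Fin n → d.peirce c 0),
      ∑ i, (x i : R) * (y i : R) = c.ι 1 := by
  obtain ⟨n, u, v, h⟩ := d.full
  have hc : c.ι 1 * c.ι 1 = c.ι 1 := c.one_mul_ι 1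
  have hd : d.ι 1 * d.ι 1 = d.ι 1 := d.one_mul_ι 1
  refine ⟨n, fun i => ⟨c.ι 1 * u i * d.ι 1, ?_, ?_, fun h => absurd rfl h⟩,
    fun i => ⟨d.ι 1 * v i * c.ι 1, ?_, ?_, fun h => absurd rfl h⟩, ?_⟩
  · rw [← mul_assoc, ← mul_assoc, hc]
  · rw [mul_assoc, hd]
  · rw [← mul_assoc, ← mul_assoc, hd]
  · rw [mul_assoc, hc]
  · calc ∑ i, c.ι 1 * u i * d.ι 1 * (d.ι 1 * v i * c.ι 1)
        = ∑ i, c.ι 1 * (u i * d.ι 1 * v i) * c.ι 1 := by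
          refine Finset.sum_congr rfl fun i _ => ?_
          simp only [mul_assoc]
          rw [← mul_assoc (d.ι 1) (d.ι 1), hd]
      _ = c.ι 1 := by rw [← Finset.sum_mul, ← Finset.mul_sum, h, mul_one, hc]

/-- The Peirce component `e R f` as a complex concentrated in degree `0`. -/
abbrev peirceComplex : CochainComplex (ModuleCat.{u} k) ℤ where
  X n := ModuleCat.of k (c.peirce d n)
  d _ _ := 0

/-- The right action of `B` on `e R f`. -/
def rightMul {p q n : ℤ} (h : p + q = n) :
    c.peirce d p →ₗ[k] algDegree k B q →ₗ[k] c.peirce d n :=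
  LinearMap.mk₂ k (fun v b => ⟨v * d.ι b, mul_ι_mem h v.2 b.2⟩)
    (fun _ _ _ => Subtype.ext (add_mul _ _ _)) (fun _ _ _ => Subtype.ext (smul_mul_assoc _ _ _))
    (fun v b b' => Subtype.ext (by simp [mul_add])) (fun a v b => Subtype.ext (by simp))

/-- The left action of `A` on `e R f`. -/
def leftMul {p q n : ℤ} (h : p + q = n) :
    algDegree k A p →ₗ[k] c.peirce d q →ₗ[k] c.peirce d n :=
  LinearMap.mk₂ k (fun a v => ⟨c.ι a * v, ι_mul_mem h a.2 v.2⟩)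
    (fun a a' v => Subtype.ext (by simp [add_mul])) (fun r a v => Subtype.ext (by simp))
    (fun _ _ _ => Subtype.ext (mul_add _ _ _)) (fun _ _ _ => Subtype.ext (mul_smul_comm _ _ _))

/-- The multiplication `e R f × f R e → e R e ≃ A`. -/
def pairing {p q n : ℤ} (h : p + q = n) :
    c.peirce d p →ₗ[k] d.peirce c q →ₗ[k] algDegree k A n :=
  LinearMap.mk₂ k (fun v w => ⟨c.π (v * w), π_mul_mem h v.2 w.2⟩)
    (fun v v' w => Subtype.ext (by simp [add_mul])) (fun r v w => Subtype.ext (by simp))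
    (fun v w w' => Subtype.ext (by simp [mul_add])) (fun r v w => Subtype.ext (by simp))

/-- The right dg module `e R f` over `B`. -/
abbrev dgMod : DGMod (DGCat.ofAlgebra k B) where
  obj _ := c.peirceComplex d
  act h := c.rightMul d h
  act_one m := Subtype.ext m.2.2.1
  act_act _ _ _ _ m a b := Subtype.ext (by
    change (m : R) * d.ι a * d.ι b = m * d.ι (a * b)
    rw [d.ι_mul, mul_assoc])
  d_act {w w' p q n p' q' n'} h hp hq hn m b := by
    change (0 : c.peirce d n') = c.rightMul d _ (0 : c.peirce d p') b
      + p.negOnePow • c.rightMul d _ m (0 : algDegree k B q')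
    rw [LinearMap.map_zero₂, map_zero, smul_zero, add_zero]

/-- The `A`-`B`-bimodule `e R f`. -/
abbrev dgBimod : DGBimod (DGCat.ofAlgebra k A) (DGCat.ofAlgebra k B) where
  right _ := c.dgMod d
  lact h := c.leftMul d h
  one_lact m := Subtype.ext m.2.1
  lact_lact _ _ _ _ a b m := Subtype.ext (by
    change c.ι (a * b) * (m : R) = c.ι a * (c.ι b * m)
    rw [c.ι_mul, mul_assoc])
  lact_act _ _ _ _ a m b := Subtype.ext (mul_assoc _ _ _)
  d_lact {x x' w p q n p' q' n'} h hp hq hn a m := by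
    change (0 : c.peirce d n') = c.leftMul d _ (0 : algDegree k A p') m
      + p.negOnePow • c.leftMul d _ a (0 : c.peirce d q')
    rw [LinearMap.map_zero₂, map_zero, smul_zero, add_zero]

/-- The multiplication of `R` exhibits `A` as the tensor product of `e R f` and `f R e` over `B`. -/
def tensorProduct :
    (c.dgBimod d).TensorProduct (d.dgBimod c) (DGBimod.diag (DGCat.ofAlgebra k A)) where
  μ h := c.pairing d h
  balanced _ _ _ _ m b v := Subtype.ext (congrArg c.π (mul_assoc _ _ _))
  lact_μ _ _ _ _ a m v := Subtype.ext (by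
    change c.π (c.ι a * (m : R) * v) = a * c.π (m * v)
    rw [mul_assoc, c.π_ι_mul])
  ract_μ _ _ _ _ m v a := Subtype.ext (by
    change c.π ((m : R) * v) * a = c.π (m * (v * c.ι a))
    rw [← mul_assoc, c.π_mul_ι])
  d_μ {x b z p q n p' q' n'} h hp hq hn m v := by
    change (0 : algDegree k A n') = c.pairing d _ (0 : c.peirce d p') v
      + p.negOnePow • c.pairing d _ m (0 : d.peirce c q')
    rw [LinearMap.map_zero₂, map_zero, smul_zero, add_zero]
  universal _ _ n W _ _ φ hφ := by
    obtain ⟨N, x, y, hxy⟩ := c.exists_sum_mul_eq d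
    let φ' (p q : ℤ) (h : p + q = n) : c.peirce d p →ₗ[k] d.peirce c q →ₗ[k] W :=
      φ PUnit.unit p q h
    -- As `a = ∑ a x i y i` for `a` in `A`, the only possible map is `a ↦ ∑ φ (a x i, y i)`.
    refine ⟨∑ i, (φ' n 0 (add_zero n)).flip (y i) ∘ₗ (c.leftMul d (add_zero n)).flip (x i), ?_, ?_⟩
    · rintro ⟨⟩ p q h (m : c.peirce d p) (v : d.peirce c q)
      refine (LinearMap.sum_apply _ _ _).trans ?_
      change ∑ i, φ' n 0 (add_zero n) (c.leftMul d (add_zero n) (c.pairing d h m v) (x i)) (y i) = _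
      by_cases hq : q = 0
      · subst hq
        obtain rfl : p = n := by omega
        -- `m v x i = m (v x i)` with `v x i ∈ f R f ≃ B`, and `∑ v x i y i = v`.
        have e₁ (i : Fin N) : c.leftMul d (add_zero p) (c.pairing d h m v) (x i) =
            c.rightMul d (add_zero p) m (d.pairing c (add_zero 0) v (x i)) := Subtype.ext (by
          change c.ι (c.π ((m : R) * v)) * x i = m * d.ι (d.π (v * x i))
          rw [ι_π_mul m.2 v.2, ι_π_mul v.2 (x i).2, mul_assoc])
        have e₂ (i : Fin N) := hφ PUnit.unit PUnit.unit p 0 0 p 0 (add_zero p) (add_zero 0)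
          (add_zero p) (add_zero p) m (d.pairing c (add_zero 0) v (x i)) (y i)
        have e₃ : ∑ i, d.leftMul c (add_zero 0) (d.pairing c (add_zero 0) v (x i)) (y i) = v :=
          Subtype.ext (by
            rw [Submodule.coe_sum]
            calc ∑ i, d.ι (d.π ((v : R) * x i)) * (y i : R) = ∑ i, v * ((x i : R) * y i) :=
                  Finset.sum_congr rfl fun i _ => by rw [ι_π_mul v.2 (x i).2, mul_assoc]
              _ = v := by rw [← Finset.mul_sum, hxy, v.2.2.1])
        calc _ = ∑ i, φ' p 0 (add_zero p) m
              (d.leftMul c (add_zero 0) (d.pairing c (add_zero 0) v (x i)) (y i)) :=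
              Finset.sum_congr rfl fun i _ => by rw [e₁]; exact e₂ i
          _ = φ' p 0 h m v := by rw [← map_sum, e₃]
      · obtain rfl : v = 0 := Subtype.ext (v.2.2.2 hq)
        simp only [map_zero, LinearMap.zero_apply, Finset.sum_const_zero]
    · intro ψ hψ
      refine LinearMap.ext fun a => ?_
      have e₁ : a = ∑ i, c.pairing d (add_zero n) (c.leftMul d (add_zero n) a (x i)) (y i) :=
        Subtype.ext (by
          rw [Submodule.coe_sum]
          calc (a : A) = ∑ i, c.π (c.ι a * ((x i : R) * y i)) := by
                rw [← map_sum, ← Finset.mul_sum, hxy, c.ι_mul_one, c.π_ι]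
            _ = _ := Finset.sum_congr rfl fun i _ => by rw [← mul_assoc]; rfl)
      rw [LinearMap.sum_apply]
      refine (congrArg ψ e₁).trans ((map_sum ψ _ _).trans (Finset.sum_congr rfl fun i _ => ?_))
      exact hψ PUnit.unit n 0 (add_zero n) _ _

end FullCorner

theorem exists_d_eq_of_acyclic {K : CochainComplex (ModuleCat.{u} k) ℤ} (hK : K.Acyclic)
    {i j l : ℤ} (hij : i + 1 = j) (hjl : j + 1 = l) (x : K.X j) (hx : K.d j l x = 0) :
    ∃ y, K.d i j y = x := by
  have h := (K.exactAt_iff' i j l (by simp; omega) (by simp; omega)).1 (hK j)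
  exact (ShortComplex.moduleCat_exact_iff _).1 h x hx

namespace FullCorner

variable {A B R : Type u} [Ring A] [Algebra k A] [Ring B] [Algebra k B] [Ring R] [Algebra k R]
  (c : FullCorner k A R) (d : FullCorner k B R)

/-- The module `e R f` is projective over `B`, with a dual basis `x i`, `y i`; so a null-homotopy of
a morphism is determined by primitives of the images of the `x i`. -/
theorem isHProjective_dgMod : (c.dgMod d).IsHProjective := by
  intro N hN f
  obtain ⟨r, x, y, hxy⟩ := c.exists_sum_mul_eq d
  have ex (i : Fin r) : ∃ n, (N.obj PUnit.unit).d (-1) 0 n = (f.app PUnit.unit).f 0 (x i) := by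
    refine exists_d_eq_of_acyclic (hN PUnit.unit) (by omega) (zero_add 1) _ ?_
    rw [← ModuleCat.comp_apply, (f.app PUnit.unit).comm]
    exact map_zero ((f.app PUnit.unit).f 1).hom
  choose n hn using ex
  -- The homotopy sends `m = ∑ x i (y i m)` to `∑ n i (y i m)`, where `d (n i) = f (x i)`.
  refine ⟨fun w p q hq => ∑ i, N.act (w := PUnit.unit) (w' := w) (p := -1) (q := p) (by omega)
    (n i) ∘ₗ d.pairing c (zero_add p) (y i), ?_, ?_⟩
  · rintro ⟨⟩ ⟨⟩ p q n' p' n'' h h' hp hn (m : c.peirce d p) (b : algDegree k B q)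
    rw [LinearMap.sum_apply, LinearMap.sum_apply, map_sum, LinearMap.sum_apply]
    refine Finset.sum_congr rfl fun i _ => ?_
    refine Eq.trans (congrArg (N.act _ (n i)) ?_) (N.act_act (w := PUnit.unit) (w' := PUnit.unit)
      (w'' := PUnit.unit) (by omega) h h' (by omega) (n i) (d.pairing c (zero_add p) (y i) m)
      b).symm
    refine Subtype.ext ?_
    change d.π ((y i : R) * (m * d.ι b)) = d.π (y i * m) * b
    rw [← mul_assoc, d.π_mul_ι]
  · rintro ⟨⟩ p q p' hq hp (m : c.peirce d p)
    have e₁ : ((c.dgMod d).obj PUnit.unit).d p p' m = 0 := rfl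
    have e₂ : m = ∑ i, c.rightMul d (zero_add p) (x i) (d.pairing c (zero_add p) (y i) m) :=
      Subtype.ext (by
        rw [Submodule.coe_sum]
        calc (m : R) = ∑ i, (x i : R) * y i * m := by rw [← Finset.sum_mul, hxy, m.2.1]
          _ = _ := Finset.sum_congr rfl fun i _ => by
            change _ = (x i : R) * d.ι (d.π (y i * m))
            rw [ι_π_mul (y i).2 m.2, mul_assoc])
    rw [e₁, map_zero, add_zero, LinearMap.sum_apply, map_sum]
    refine (congrArg ((f.app PUnit.unit).f p) e₂).trans
      ((map_sum ((f.app PUnit.unit).f p).hom _ _).trans (Finset.sum_congr rfl fun i _ => ?_))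
    have e₃ := N.d_act (w := PUnit.unit) (w' := PUnit.unit) (p := -1) (p' := 0) (q := p)
      (q' := p + 1) (n := q) (n' := p) (by omega) (by omega) rfl hq (n i)
      (d.pairing c (zero_add p) (y i) m)
    have e₄ : ((DGCat.ofAlgebra k B).Hom PUnit.unit PUnit.unit).d p (p + 1)
      (d.pairing c (zero_add p) (y i) m) = 0 := rfl
    rw [e₄, map_zero, smul_zero, add_zero, hn] at e₃
    exact (f.app_act (w := PUnit.unit) (w' := PUnit.unit) (zero_add p) (x i)
      (d.pairing c (zero_add p) (y i) m)).trans e₃.symm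

theorem isDerivedTensor :
    DGBimod.IsDerivedTensor (c.dgBimod d) (d.dgBimod c) (DGBimod.diag (DGCat.ofAlgebra k A)) :=
  ⟨c.dgBimod d, 𝟙 _, DGBimod.diag (DGCat.ofAlgebra k A),
    fun _ _ => inferInstanceAs (QuasiIso (𝟙 (c.peirceComplex d))),
    fun _ => c.isHProjective_dgMod d, ⟨c.tensorProduct d⟩, ⟨Iso.refl _⟩⟩

theorem isRep [FiniteDimensional k R] [IsSemisimpleRing B] : (c.dgBimod d).IsRep := fun _ =>
  DGMod.IsTotallyFinite.isCompact DGMod.hasMinimalModels_ofAlgebra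
    ⟨fun _ n => inferInstanceAs (Module.Finite k (c.peirce d n)), {(PUnit.unit, 0)},
      fun _ n hn => ⟨fun v w => by
        have hn : n ≠ 0 := fun h => hn (by simp [h])
        exact Subtype.ext (((v : c.peirce d n).2.2.2 hn).trans
          ((w : c.peirce d n).2.2.2 hn).symm)⟩⟩

end FullCorner

theorem isRep_diag (A : Type u) [Ring A] [Algebra k A] [FiniteDimensional k A]
    [IsSemisimpleRing A] : (DGBimod.diag (DGCat.ofAlgebra k A)).IsRep := fun _ =>
  DGMod.IsTotallyFinite.isCompact DGMod.hasMinimalModels_ofAlgebra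
    ⟨fun _ n => inferInstanceAs (Module.Finite k (algDegree k A n)), {(PUnit.unit, 0)},
      fun _ n hn => ⟨fun v w => by
        have hn : n ≠ 0 := fun h => hn (by simp [h])
        exact Subtype.ext (((v : algDegree k A n).2 hn).trans
          ((w : algDegree k A n).2 hn).symm)⟩⟩

/-- Full corners of the same algebra are Morita equivalent, and have isomorphic motives. -/
theorem FullCorner.isomorphic {A B R : Type u} [Ring A] [Algebra k A] [Ring B] [Algebra k B]
    [Ring R] [Algebra k R] [FiniteDimensional k A] [FiniteDimensional k B] [FiniteDimensional k R]
    [IsSemisimpleRing A] [IsSemisimpleRing B] (c : FullCorner k A R) (d : FullCorner k B R) :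
    Hmo0.Isomorphic (U (DGCat.ofAlgebra k A)) (U (DGCat.ofAlgebra k B)) :=
  ⟨Hmo0.cls (c.dgBimod d) (c.isRep d), Hmo0.cls (d.dgBimod c) (d.isRep c),
    Hmo0.cls (DGBimod.diag _) (isRep_diag A), Hmo0.cls (DGBimod.diag _) (isRep_diag B),
    ⟨_, rfl⟩, ⟨_, rfl⟩, .tensor _ _ _ _ _ _ (c.isDerivedTensor d),
    .tensor _ _ _ _ _ _ (d.isDerivedTensor c)⟩

theorem isomorphic_of_isBrauerEquivalent (A B : CSA.{u, u} k) (h : IsBrauerEquivalent A B) :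
    Hmo0.Isomorphic (U (DGCat.ofAlgebra k A)) (U (DGCat.ofAlgebra k B)) := by
  obtain ⟨n, m, hn, hm, ⟨e⟩⟩ := h
  have : NeZero n := ⟨hn⟩
  have : NeZero m := ⟨hm⟩
  have : IsArtinianRing A := IsArtinianRing.of_finite k A
  have : IsArtinianRing B := IsArtinianRing.of_finite k B
  exact ((FullCorner.matrix A n).trans e).isomorphic (FullCorner.matrix B m)

theorem theorem8p1 {k : Type u} [Field k] (A B : CSA.{u, u} k) :
    Hmo0.Isomorphic (U (DGCat.ofAlgebra k A)) (U (DGCat.ofAlgebra k B)) ↔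
      (Quotient.mk (Brauer.CSA_Setoid k) A : BrauerGroup k) =
        (Quotient.mk (Brauer.CSA_Setoid k) B : BrauerGroup k) :=
  ⟨fun h => Quotient.sound (isBrauerEquivalent_of_isomorphic A B h),
    fun h => isomorphic_of_isBrauerEquivalent A B (Quotient.exact h)⟩
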